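/- Let $\Gamma$ be a discrete group and let $Y\subset\Gamma$ be a finite set with $|Y|=q+1$ elements, $q\ge 2$, such that $Y^{-1}Y=\{s^{-1}t : s,t\in Y\}$ generates $\Gamma$. On the group ring $\mathbb C\Gamma$ let $\left(\sum_x c_x x\right)^*=\sum_x\overline{c_x}\,x^{-1}$, let $\tau\left(\sum_x c_x x\right)=c_e$, and let $\|a\|_2=\tau(a^*a)^{1/2}$. For $n\ge 1$ put $$E_n=\{(s_1,\dots,s_n)\in Y^n : s_i\ne s_{i+1}\ (1\le i\le n-1)\},\qquad \tilde E_{2n}=\{(s_1,\dots,s_{2n})\in E_{2n} : s_{2n}\ne s_1\},$$ $$h_n=\sum_{(s_1,\dots,s_n)\in E_n}s_1^{-1}s_2\cdots s_{n-1}^{-1}s_n\ \ (n\text{ even}),\qquad h_n=\sum_{(s_1,\dots,s_n)\in E_n}s_1s_2^{-1}s_3\cdots s_{n-1}^{-1}s_n\ \ (n\text{ odd}),$$ $$z_n=\sum_{(s_1,\dots,s_{2n})\in\tilde E_{2n}}s_1^{-1}s_2\cdots s_{2n-1}^{-1}s_{2n},\qquad h=\sum_{s\in Y}s,$$ $$\xi_n=\|h_n\|_2^2-(q+1)q^{n-1},\qquad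 \eta_n=\tau(h_{2n}),\qquad \zeta_n=\tau(z_n),\qquad m_n=\tau\big((h^*h)^n\big).$$ (The numbers $\xi_n,\eta_n,\zeta_n,m_n$ are nonnegative integers.) Then the following are equivalent, where each limit statement means that the limit exists and has the stated value: (i) $\Gamma$ is amenable, i.e. there is a left-invariant mean on $\ell^\infty(\Gamma)$; (ii) $\lim_{n\to\infty}\|h_n\|_2^{1/n}=q$; (iii) $\lim_{n\to\infty}\xi_n^{1/(2n)}=q$; (iv) $\lim_{n\to\infty}\eta_n^{1/(2n)}=q$; (v) $\lim_{n\to\infty}\zeta_n^{1/(2n)}=q$. Moreover, $\Gamma$ is amenable if and only if $\lim_{n\to\infty}m_n^{1/(2n)}=q+1$. -/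

import Mathlib

open Filter Topology
open scoped Pointwise ENNReal

noncomputable section

namespace GroupCogrowth

variable {Γ : Type*} [Group Γ]

/-! ### Amenability of a discrete group -/

/-- The left translate `x ↦ f (g⁻¹ x)` of a bounded function `f ∈ ℓ^∞(Γ)`. -/
def leftTranslate (g : Γ) (f : lp (fun _ : Γ => ℝ) ∞) : lp (fun _ : Γ => ℝ) ∞ :=
  ⟨fun x => f (g⁻¹ * x), memℓp_infty ⟨‖f‖, by
    rintro _ ⟨x, rfl⟩
    exact lp.norm_apply_le_norm ENNReal.top_ne_zero f (g⁻¹ * x)⟩⟩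

/-- A discrete group `Γ` is amenable if `ℓ^∞(Γ)` carries a left invariant mean, that is, a
positive, unital linear functional which is invariant under left translations. -/
def Amenable (Γ : Type*) [Group Γ] : Prop :=
  ∃ m : lp (fun _ : Γ => ℝ) ∞ →ₗ[ℝ] ℝ,
    (∀ f : lp (fun _ : Γ => ℝ) ∞, (∀ x, 0 ≤ f x) → 0 ≤ m f) ∧
    m 1 = 1 ∧
    ∀ (g : Γ) (f : lp (fun _ : Γ => ℝ) ∞), m (leftTranslate g f) = m f

/-! ### The group ring `ℂΓ`, its involution, trace and 2-norm -/

/-- The involution `(∑ c_x x)^* = ∑ conj(c_x) x⁻¹` of the group ring. -/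
def adjoint (a : MonoidAlgebra ℂ Γ) : MonoidAlgebra ℂ Γ :=
  a.coeff.sum fun x c => MonoidAlgebra.single x⁻¹ (starRingEnd ℂ c)

/-- The canonical trace `τ(∑ c_x x) = c_e` on the group ring. -/
def trace (a : MonoidAlgebra ℂ Γ) : ℂ := a.coeff 1

/-- The 2-norm `‖a‖₂ = τ(a^* a)^{1/2}`; here `τ(a^* a) = ∑ |c_x|²` is real and nonnegative. -/
def norm2 (a : MonoidAlgebra ℂ Γ) : ℝ := Real.sqrt (trace (adjoint a * a)).re

/-! ### Reduced and cyclically reduced words -/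

open Classical in
/-- `E_n`: tuples `(s_1, …, s_n)` in `Y^n` with `s_1 ≠ s_2 ≠ ⋯ ≠ s_n` (consecutive entries
are distinct). The entry `s_{i+1}` is `s i`. -/
def reducedWords (Y : Finset Γ) (n : ℕ) : Finset (Fin n → Γ) :=
  (Fintype.piFinset fun _ : Fin n => Y).filter fun s =>
    ∀ i j : Fin n, (j : ℕ) = i + 1 → s i ≠ s j

open Classical in
/-- `Ẽ_n`: the tuples `(s_1, …, s_n)` in `E_n` with moreover `s_n ≠ s_1`. -/
def cyclicWords (Y : Finset Γ) (n : ℕ) : Finset (Fin n → Γ) :=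
  (reducedWords Y n).filter fun s =>
    ∀ i j : Fin n, (i : ℕ) = 0 → (j : ℕ) + 1 = n → s j ≠ s i

/-- The alternating product of `(s_1, …, s_n)` that ends in `s_n`: it is
`s_1⁻¹ s_2 ⋯ s_{n-1}⁻¹ s_n` for `n` even and `s_1 s_2⁻¹ s_3 ⋯ s_{n-1}⁻¹ s_n` for `n` odd. -/
def altProd {n : ℕ} (s : Fin n → Γ) : Γ :=
  (List.ofFn fun i : Fin n => if Even (n + i + 1) then s i else (s i)⁻¹).prod

/-! ### The elements `h`, `h_n`, `z_n` of the group ring and the numerical sequences -/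

/-- `h = ∑_{s ∈ Y} s`. -/
def h (Y : Finset Γ) : MonoidAlgebra ℂ Γ := ∑ s ∈ Y, MonoidAlgebra.single s 1

/-- `h_n`, the sum of the alternating products over `E_n`. -/
def hSeq (Y : Finset Γ) (n : ℕ) : MonoidAlgebra ℂ Γ :=
  ∑ s ∈ reducedWords Y n, MonoidAlgebra.single (altProd s) 1

/-- `z_n`, the sum of the alternating products over `Ẽ_{2n}`. -/
def zSeq (Y : Finset Γ) (n : ℕ) : MonoidAlgebra ℂ Γ :=
  ∑ s ∈ cyclicWords Y (2 * n), MonoidAlgebra.single (altProd s) 1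

/-- `ξ_n = ‖h_n‖₂² - (q+1) q^{n-1}` for `n ≥ 1`, where `|Y| = q + 1`. -/
def xi (Y : Finset Γ) (q n : ℕ) : ℝ := norm2 (hSeq Y n) ^ 2 - ((q : ℝ) + 1) * (q : ℝ) ^ (n - 1)

/-- `η_n = τ(h_{2n})`, a nonnegative integer. -/
def eta (Y : Finset Γ) (n : ℕ) : ℝ := (trace (hSeq Y (2 * n))).re

/-- `ζ_n = τ(z_n)`, a nonnegative integer. -/
def zeta (Y : Finset Γ) (n : ℕ) : ℝ := (trace (zSeq Y n)).re

/-- The moments `m_n = τ((h^* h)^n)`, which are nonnegative integers. -/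
def moment (Y : Finset Γ) (n : ℕ) : ℝ := (trace ((adjoint (h Y) * h Y) ^ n)).re

end GroupCogrowth

end

/-! Let A = h^*h act on ℓ²(Γ) through the left regular representation λ. The analytic core is a
Kesten criterion: Γ is amenable exactly when ‖λ(h)‖ = q+1. Almost maximal vectors for λ(h) are
almost fixed by all s⁻¹t, and an ultrafilter limit of their densities is an invariant mean
(`amenable_of_card_le_norm`). Conversely, a mean yields almost invariant, finitely supported
densities by Hahn-Banach (`exists_norm_boundary_lt`), and their square roots force m_n ≥ c bⁿ for
every 0 < b < (q+1)² (`exists_mul_pow_le_moment`). This settles the statement about m_n.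

Three identities tie the word counts to A: ζ_n = τ(Q_n(A)) + q - 1 (`zeta_eq`), η_{n+1} - qη_n =
ζ_{n+1} - ζ_n (`eta_succ`) and ξ_{n+1} - qξ_n = η_{n+1} - η_n (`xi_succ`), where Q_n(u + q²/u + 2q)
= uⁿ + (q²/u)ⁿ. The substitution x = u + q²/u + 2q maps [q, q²] increasingly onto [4q, (q+1)²], and
on [0, 4q] one has |Q_n| ≤ 2qⁿ. Hence the top of the spectrum of λ(A) governs the growth of ζ_n.

If Γ is not amenable, then ζ_n = O(bⁿ) with some b < q² (`exists_zeta_le_mul_pow`), and the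
recursions pass this bound on to η_n, ξ_n and ‖h_n‖₂². If Γ is amenable, then ζ_n ≥ c bⁿ eventually
for every q < b < q² (`exists_mul_pow_le_zeta`), and ζ_n ≤ η_n ≤ ξ_n ≤ ‖h_n‖₂² = O(q²ⁿ) squeezes all
four. -/

namespace GroupCogrowth

/-! ### Exponential growth rates of real sequences -/

lemma eventually_mul_pow_lt_mul_pow {b d c : ℝ} (C : ℝ) (hb : 0 < b) (hbd : b < d) (hc : 0 < c) :
    ∀ᶠ n : ℕ in atTop, C * b ^ n < c * d ^ n := by
  have h := tendsto_pow_atTop_atTop_of_one_lt ((one_lt_div hb).2 hbd)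
  filter_upwards [h.eventually_gt_atTop (C / c)] with n hn
  rw [div_pow, div_lt_div_iff₀ hc (by positivity)] at hn
  linarith

lemma lt_rpow_one_div_two_mul {a x : ℝ} {n : ℕ} (hn : n ≠ 0) (hx : (a ^ 2) ^ n < x) :
    a < x ^ (1 / (2 * (n : ℝ))) := by
  have hx0 : 0 ≤ x := le_trans (by positivity) hx.le
  have h2 : (2 * (n : ℝ)) = ((2 * n : ℕ) : ℝ) := by push_cast; ring
  rw [h2, one_div]
  refine lt_of_pow_lt_pow_left₀ (2 * n) (by positivity) ?_
  rwa [Real.rpow_inv_natCast_pow hx0 (by omega), pow_mul]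

lemma rpow_one_div_two_mul_lt {a x : ℝ} {n : ℕ} (hn : n ≠ 0) (ha : 0 ≤ a) (hx0 : 0 ≤ x)
    (hx : x < (a ^ 2) ^ n) : x ^ (1 / (2 * (n : ℝ))) < a := by
  have h2 : (2 * (n : ℝ)) = ((2 * n : ℕ) : ℝ) := by push_cast; ring
  rw [h2, one_div]
  refine lt_of_pow_lt_pow_left₀ (2 * n) ha ?_
  rwa [Real.rpow_inv_natCast_pow hx0 (by omega), pow_mul]

/-- A sequence that is `O(bⁿ)` with `b < B²` does not have growth rate `B`. -/
lemma not_tendsto_root {x : ℕ → ℝ} {C b B : ℝ} (hb : 0 < b) (hB : 0 < B) (hbB : b < B ^ 2)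
    (hx0 : ∀ᶠ n in atTop, 0 ≤ x n) (hx : ∀ᶠ n in atTop, x n ≤ C * b ^ n) :
    ¬ Tendsto (fun n : ℕ => x n ^ (1 / (2 * (n : ℝ)))) atTop (𝓝 B) := by
  intro h
  obtain ⟨d, hd1, hd2⟩ := exists_between hbB
  have hd0 : 0 < d := hb.trans hd1
  have hsd : √d < B := (Real.sqrt_lt' hB).2 hd2
  obtain ⟨n, h1, h2, h3, h4, h5⟩ := ((h.eventually_const_lt hsd).and (hx0.and (hx.and
    ((eventually_mul_pow_lt_mul_pow C hb hd1 one_pos).and (eventually_ne_atTop 0))))).exists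
  refine lt_asymm h1 (rpow_one_div_two_mul_lt h5 (Real.sqrt_nonneg d) h2 ?_)
  rw [Real.sq_sqrt hd0.le]
  linarith

/-- A sequence that is `O(B²ⁿ)` and is bounded below by a multiple of `bⁿ` for every `b < B²`
has growth rate `B`. -/
lemma tendsto_root {x : ℕ → ℝ} {C b₀ B : ℝ} (hB : 0 < B) (hbB : b₀ < B ^ 2)
    (hlow : ∀ b, b₀ < b → b < B ^ 2 → ∃ c > 0, ∀ᶠ n in atTop, c * b ^ n ≤ x n)
    (hupp : ∀ᶠ n in atTop, x n ≤ C * (B ^ 2) ^ n) :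
    Tendsto (fun n : ℕ => x n ^ (1 / (2 * (n : ℝ)))) atTop (𝓝 B) := by
  have key : ∀ a, 0 < a → a < B → ∀ᶠ n : ℕ in atTop, (a ^ 2) ^ n < x n := by
    intro a ha haB
    obtain ⟨b, hb1, hb2⟩ := exists_between (max_lt hbB (pow_lt_pow_left₀ haB ha.le two_ne_zero))
    obtain ⟨c, hc, hlow⟩ := hlow b ((le_max_left _ _).trans_lt hb1) hb2
    filter_upwards [hlow, eventually_mul_pow_lt_mul_pow 1 (by positivity)
      ((le_max_right _ _).trans_lt hb1) hc] with n h1 h2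
    linarith
  refine tendsto_order.2 ⟨fun a ha => ?_, fun a ha => ?_⟩
  · obtain ⟨a', ha1, ha2⟩ := exists_between (max_lt hB ha)
    have h0 : 0 < a' := (le_max_left _ _).trans_lt ha1
    filter_upwards [key a' h0 ha2, eventually_ne_atTop 0] with n h1 h2
    exact ((le_max_right _ _).trans_lt ha1).trans (lt_rpow_one_div_two_mul h2 h1)
  · filter_upwards [key (B / 2) (by positivity) (by linarith), hupp, eventually_ne_atTop 0,
      eventually_mul_pow_lt_mul_pow C (by positivity)
        (pow_lt_pow_left₀ ha hB.le two_ne_zero) one_pos] with n h1 h2 h3 h4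
    exact rpow_one_div_two_mul_lt h3 (by linarith) (le_trans (by positivity) h1.le) (by linarith)

/-! ### The Chebyshev polynomials of the first kind attached to `q` -/

open Polynomial in
/-- The polynomials with `Q_n(u + v + 2q) = uⁿ + vⁿ` whenever `u v = q²`. -/
noncomputable def chebyPoly (q : ℕ) : ℕ → ℝ[X]
  | 0 => 2
  | 1 => X - C (2 * (q : ℝ))
  | n + 2 => (X - C (2 * (q : ℝ))) * chebyPoly q (n + 1) - C ((q : ℝ) ^ 2) * chebyPoly q n

lemma chebyPoly_eval_add {q : ℕ} {u v : ℝ} (huv : u * v = (q : ℝ) ^ 2) :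
    ∀ n, (chebyPoly q n).eval (u + v + 2 * q) = u ^ n + v ^ n
  | 0 => by simp [chebyPoly]; norm_num
  | 1 => by simp [chebyPoly]
  | n + 2 => by
    simp only [chebyPoly, Polynomial.eval_sub, Polynomial.eval_mul, Polynomial.eval_X,
      Polynomial.eval_C, chebyPoly_eval_add huv (n + 1), chebyPoly_eval_add huv n, ← huv]
    ring

lemma chebyPoly_eval_cos {q : ℕ} (θ : ℝ) :
    ∀ n, (chebyPoly q n).eval (2 * q * Real.cos θ + 2 * q) = 2 * q ^ n * Real.cos (n * θ)
  | 0 => by simp [chebyPoly]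
  | 1 => by simp [chebyPoly]
  | n + 2 => by
    simp only [chebyPoly, Polynomial.eval_sub, Polynomial.eval_mul, Polynomial.eval_X,
      Polynomial.eval_C, chebyPoly_eval_cos θ (n + 1), chebyPoly_eval_cos θ n]
    have h1 : ((n + 2 : ℕ) : ℝ) * θ = ((n + 1 : ℕ) : ℝ) * θ + θ := by push_cast; ring
    have h2 : (n : ℝ) * θ = ((n + 1 : ℕ) : ℝ) * θ - θ := by push_cast; ring
    rw [h1, h2, Real.cos_add, Real.cos_sub]
    ring

/-- On `[0, ∞)` the polynomial `Q_n` is either trigonometric or hyperbolic. -/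
lemma chebyPoly_eval_cases {q : ℕ} (hq : 0 < q) {x : ℝ} (hx : 0 ≤ x) :
    (x ≤ 4 * q ∧ ∀ n, |(chebyPoly q n).eval x| ≤ 2 * q ^ n) ∨
    ∃ u : ℝ, q ≤ u ∧ x = u + q ^ 2 / u + 2 * q ∧
      ∀ n, (chebyPoly q n).eval x = u ^ n + (q ^ 2 / u) ^ n := by
  have hq' : (0 : ℝ) < q := by exact_mod_cast hq
  rcases le_or_gt x (4 * q) with h | h
  · refine Or.inl ⟨h, fun n => ?_⟩
    have hx' : x = 2 * q * Real.cos (Real.arccos ((x - 2 * q) / (2 * q))) + 2 * q := by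
      rw [Real.cos_arccos]
      · field_simp; ring
      · rw [le_div_iff₀ (by positivity)]; linarith
      · rw [div_le_iff₀ (by positivity)]; linarith
    rw [hx', chebyPoly_eval_cos, abs_mul, abs_of_nonneg (by positivity)]
    exact mul_le_of_le_one_right (by positivity) (Real.abs_cos_le_one _)
  · right
    have hD : 0 ≤ (x - 2 * q) ^ 2 - 4 * q ^ 2 := by nlinarith
    -- `D²` is the discriminant of u² - (x - 2q)u + q². The witness is the larger root, hence at
    -- least q; the roots have product q².
    set D := √((x - 2 * q) ^ 2 - 4 * q ^ 2) with hDdef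
    have hD2 : D ^ 2 = (x - 2 * q) ^ 2 - 4 * q ^ 2 := Real.sq_sqrt hD
    have hD0 : 0 ≤ D := Real.sqrt_nonneg _
    have hu : (0 : ℝ) < (x - 2 * q + D) / 2 := by linarith
    have hv : (q : ℝ) ^ 2 / ((x - 2 * q + D) / 2) = (x - 2 * q - D) / 2 := by
      rw [div_eq_iff hu.ne']; linarith
    have hx' : x = (x - 2 * q + D) / 2 + (q : ℝ) ^ 2 / ((x - 2 * q + D) / 2) + 2 * q := by
      rw [hv]; ring
    refine ⟨(x - 2 * q + D) / 2, by linarith, hx', fun n => ?_⟩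
    conv_lhs => rw [hx']
    exact chebyPoly_eval_add (mul_div_cancel₀ _ hu.ne') n

/-- The difference of the two sides is (v - u)(uv - q²)/(uv), and uv > q². This makes u a monotone
coordinate on the hyperbolic range of Q_n. -/
lemma add_div_strictMono {q u v : ℝ} (hq : 0 < q) (hu : q ≤ u) (huv : u < v) :
    u + q ^ 2 / u < v + q ^ 2 / v := by
  have h0 : 0 < u := hq.trans_le hu
  have h1 : 0 < v := h0.trans huv
  have : v + q ^ 2 / v - (u + q ^ 2 / u) = (v - u) * (u * v - q ^ 2) / (u * v) := by
    field_simp; ring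
  have h2 : 0 < (v - u) * (u * v - q ^ 2) / (u * v) := by
    have : 0 < u * v - q ^ 2 := by nlinarith
    have : 0 < v - u := by linarith
    positivity
  linarith

lemma neg_le_chebyPoly_eval {q : ℕ} (hq : 0 < q) {x : ℝ} (hx : 0 ≤ x) (n : ℕ) :
    -(2 * (q : ℝ) ^ n) ≤ (chebyPoly q n).eval x := by
  have hq' : (0 : ℝ) < q := by exact_mod_cast hq
  rcases chebyPoly_eval_cases hq hx with ⟨-, h⟩ | ⟨u, hu, -, h⟩
  · exact (abs_le.1 (h n)).1
  · have : 0 < u := hq'.trans_le hu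
    rw [h n]
    have : 0 ≤ 2 * (q : ℝ) ^ n + (u ^ n + (q ^ 2 / u) ^ n) := by positivity
    linarith

/-- Feeds the nonamenable case. In the hyperbolic range both u and q²/u are at most b; elsewhere 2qⁿ
suffices. -/
lemma chebyPoly_eval_le {q : ℕ} (hq : 0 < q) {b x : ℝ} (hb : q ≤ b) (hx : 0 ≤ x)
    (hxb : x ≤ b + q ^ 2 / b + 2 * q) (n : ℕ) : (chebyPoly q n).eval x ≤ 2 * b ^ n := by
  have hq' : (0 : ℝ) < q := by exact_mod_cast hq
  rcases chebyPoly_eval_cases hq hx with ⟨-, h⟩ | ⟨u, hu, hxu, h⟩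
  · refine (abs_le.1 (h n)).2.trans ?_
    gcongr
  · have hub : u ≤ b := by
      by_contra! hlt
      have := add_div_strictMono hq' hb hlt
      linarith
    have hu0 : 0 < u := hq'.trans_le hu
    have hv : q ^ 2 / u ≤ b := by
      rw [div_le_iff₀ hu0]; nlinarith
    rw [h n, two_mul]
    gcongr

/-- Feeds the amenable case. The bound on x exceeds 4q, so only the hyperbolic range occurs, and
there u ≥ b. -/
lemma le_chebyPoly_eval {q : ℕ} (hq : 0 < q) {b x : ℝ} (hb : q < b)
    (hxb : b + q ^ 2 / b + 2 * q ≤ x) (n : ℕ) : b ^ n ≤ (chebyPoly q n).eval x := by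
  have hq' : (0 : ℝ) < q := by exact_mod_cast hq
  have hb0 : 0 < b := hq'.trans hb
  have h2q := add_div_strictMono hq' le_rfl hb
  have h3 : (q : ℝ) + q ^ 2 / q = 2 * q := by field_simp; ring
  rcases chebyPoly_eval_cases hq (x := x) (le_trans (by positivity) hxb) with
    ⟨h4, h⟩ | ⟨u, hu, hxu, h⟩
  · linarith
  · have hub : b ≤ u := by
      by_contra! hlt
      have := add_div_strictMono hq' hu hlt
      linarith
    have hu0 : 0 < u := hq'.trans_le hu
    rw [h n]
    have : b ^ n ≤ u ^ n := by gcongr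
    have : 0 ≤ (q ^ 2 / u) ^ n := by positivity
    linarith

/-- If `y` obeys `y_{n+1} = x_{n+1} - x_n + q y_n` and `x ≥ 0` is `O(bⁿ)` with `b > q`, then so
is `y`. -/
lemma exists_le_mul_pow_of_rec {x y : ℕ → ℝ} {q C b : ℝ} (hq : 0 ≤ q) (hqb : q < b)
    (hx0 : ∀ n, 1 ≤ n → 0 ≤ x n) (hx : ∀ n, 1 ≤ n → x n ≤ C * b ^ n) (h1 : y 1 = x 1)
    (hrec : ∀ n, 1 ≤ n → y (n + 1) = x (n + 1) - x n + q * y n) :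
    ∃ C', ∀ n, 1 ≤ n → y n ≤ C' * b ^ n := by
  have hb : 0 < b := hq.trans_lt hqb
  have hbq : 0 < b - q := sub_pos.2 hqb
  have hC : 0 ≤ C := by
    have := (hx0 1 le_rfl).trans (hx 1 le_rfl)
    rw [pow_one] at this
    exact nonneg_of_mul_nonneg_left this hb
  -- The constant K solves K b = C b + q K, so the bound reproduces itself under the recursion once
  -- -x_n ≤ 0 is dropped.
  refine ⟨C * b / (b - q), fun n hn => ?_⟩
  induction n, hn using Nat.le_induction with
  | base =>
    rw [h1]
    refine (hx 1 le_rfl).trans ?_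
    have : C ≤ C * b / (b - q) := by rw [le_div_iff₀ hbq]; nlinarith
    gcongr
  | succ n hn ih =>
    rw [hrec n hn]
    have e : C * b / (b - q) * b ^ (n + 1) = C * b ^ (n + 1) + q * (C * b / (b - q) * b ^ n) := by
      field_simp; ring
    have := hx0 n hn
    have := hx (n + 1) (by omega)
    have := mul_le_mul_of_nonneg_left ih hq
    linarith

end GroupCogrowth

namespace GroupCogrowth

/-! ### Reduced words -/

section Words

variable {Γ : Type*}


lemma mem_reducedWords {Y : Finset Γ} {n : ℕ} {s : Fin n → Γ} :
    s ∈ reducedWords Y n ↔ (∀ i, s i ∈ Y) ∧ ∀ i j : Fin n, (j : ℕ) = i + 1 → s i ≠ s j := by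
  simp [reducedWords]

lemma cons_mem_reducedWords {Y : Finset Γ} {n : ℕ} {a : Γ} {w : Fin (n + 1) → Γ} :
    (Fin.cons a w : Fin (n + 2) → Γ) ∈ reducedWords Y (n + 2) ↔
      a ∈ Y ∧ a ≠ w 0 ∧ w ∈ reducedWords Y (n + 1) := by
  simp only [mem_reducedWords]
  constructor
  · rintro ⟨h1, h2⟩
    refine ⟨h1 0, ?_, fun i => h1 i.succ, fun i j hij => ?_⟩
    · have := h2 0 1 (by simp)
      simpa using this
    · have := h2 i.succ j.succ (by simp [hij])
      simpa using this
  · rintro ⟨h1, h2, h3, h4⟩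
    refine ⟨fun i => ?_, fun i j hij => ?_⟩
    · refine Fin.cases ?_ (fun i => ?_) i
      · simpa using h1
      · simpa using h3 i
    · revert hij
      refine Fin.cases ?_ (fun j => ?_) j
      · simp
      · refine Fin.cases ?_ (fun i => ?_) i
        · intro hij
          obtain rfl : j = 0 := by ext; simpa using hij
          simpa using h2
        · intro hij
          simpa using h4 i j (by simpa using hij)

open Classical in
/-- Removing the first letter of a reduced word. -/
lemma sum_reducedWords_succ_succ {M : Type*} [AddCommMonoid M] (Y : Finset Γ) (n : ℕ)
    (f : (Fin (n + 2) → Γ) → M) :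
    ∑ s ∈ reducedWords Y (n + 2), f s =
      ∑ w ∈ reducedWords Y (n + 1), ∑ a ∈ Y.erase (w 0), f (Fin.cons a w) := by
  rw [Finset.sum_sigma']
  symm
  refine Finset.sum_bij' (fun p _ => Fin.cons p.2 p.1) (fun s _ => ⟨Fin.tail s, s 0⟩) ?_ ?_ ?_ ?_ ?_
  · rintro ⟨w, a⟩ h
    simp only [Finset.mem_sigma, Finset.mem_erase] at h
    exact cons_mem_reducedWords.2 ⟨h.2.2, h.2.1, h.1⟩
  · intro s h
    rw [← Fin.cons_self_tail s, cons_mem_reducedWords] at h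
    simp only [Finset.mem_sigma, Finset.mem_erase]
    exact ⟨h.2.2, h.2.1, h.1⟩
  · rintro ⟨w, a⟩ _
    simp
  · intro s _
    simp
  · simp

lemma sum_reducedWords_one {M : Type*} [AddCommMonoid M] (Y : Finset Γ)
    (f : (Fin 1 → Γ) → M) :
    ∑ s ∈ reducedWords Y 1, f s = ∑ a ∈ Y, f (fun _ => a) := by
  symm
  refine Finset.sum_bij' (fun a _ _ => a) (fun s _ => s 0) ?_ ?_ ?_ ?_ ?_
  · intro a ha
    refine mem_reducedWords.2 ⟨fun _ => ha, fun i j hij => ?_⟩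
    omega
  · intro s h
    exact (mem_reducedWords.1 h).1 0
  · simp
  · intro s _
    funext i
    rw [Subsingleton.elim i 0]
  · simp

lemma card_reducedWords {Y : Finset Γ} {q : ℕ} (hY : Y.card = q + 1) (n : ℕ) :
    (reducedWords Y (n + 1)).card = (q + 1) * q ^ n := by
  classical
  induction n with
  | zero =>
    rw [Finset.card_eq_sum_ones, sum_reducedWords_one, ← Finset.card_eq_sum_ones, hY]
    simp
  | succ n ih =>
    rw [Finset.card_eq_sum_ones, sum_reducedWords_succ_succ]
    have : ∀ w ∈ reducedWords Y (n + 1), ∑ a ∈ Y.erase (w 0), 1 = q := by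
      intro w hw
      rw [← Finset.card_eq_sum_ones, Finset.card_erase_of_mem ((mem_reducedWords.1 hw).1 0), hY]
      rfl
    rw [Finset.sum_congr rfl this, Finset.sum_const, ih, smul_eq_mul]
    ring

end Words

variable {Γ : Type*} [Group Γ]

/-! ### The involution and the trace on sums of group elements -/

lemma adjoint_single (x : Γ) (c : ℂ) :
    adjoint (MonoidAlgebra.single x c) = MonoidAlgebra.single x⁻¹ (starRingEnd ℂ c) := by
  simp [adjoint, Finsupp.sum_single_index]

lemma adjoint_zero : adjoint (0 : MonoidAlgebra ℂ Γ) = 0 := by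
  simp [adjoint]

lemma adjoint_add (a b : MonoidAlgebra ℂ Γ) : adjoint (a + b) = adjoint a + adjoint b := by
  classical
  unfold adjoint
  rw [MonoidAlgebra.coeff_add]
  exact Finsupp.sum_add_index' (by simp) (by simp [MonoidAlgebra.single_add])

lemma adjoint_sum {ι : Type*} (s : Finset ι) (f : ι → MonoidAlgebra ℂ Γ) :
    adjoint (∑ i ∈ s, f i) = ∑ i ∈ s, adjoint (f i) :=
  map_sum (⟨⟨adjoint, adjoint_zero⟩, adjoint_add⟩ : MonoidAlgebra ℂ Γ →+ MonoidAlgebra ℂ Γ) f s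

lemma adjoint_h (Y : Finset Γ) : adjoint (h Y) = ∑ s ∈ Y, MonoidAlgebra.single s⁻¹ 1 := by
  simp [h, adjoint_sum, adjoint_single]

/-- The trace as a real linear functional. -/
noncomputable def reTrace : MonoidAlgebra ℂ Γ →ₗ[ℝ] ℝ where
  toFun a := (trace a).re
  map_add' a b := by simp [trace]
  map_smul' c a := by simp [trace]

lemma reTrace_apply (a : MonoidAlgebra ℂ Γ) : reTrace a = (trace a).re := rfl

lemma reTrace_one : reTrace (1 : MonoidAlgebra ℂ Γ) = 1 := by
  simp [reTrace_apply, trace, MonoidAlgebra.one_def]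

open Classical in
lemma reTrace_sum_single {ι : Type*} (s : Finset ι) (f : ι → Γ) :
    reTrace (∑ i ∈ s, MonoidAlgebra.single (f i) (1 : ℂ)) = ∑ i ∈ s, if f i = 1 then 1 else 0 := by
  rw [map_sum]
  refine Finset.sum_congr rfl fun i _ => ?_
  rw [reTrace_apply, trace, MonoidAlgebra.coeff_single, Finsupp.single_apply]
  split_ifs <;> simp

/-! ### Alternating products and the recursion for `h_n` -/

lemma altProd_cons {n : ℕ} (a : Γ) (w : Fin n → Γ) :
    altProd (Fin.cons a w : Fin (n + 1) → Γ) = (if Even n then a else a⁻¹) * altProd w := by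
  have h1 : Even (n + 1 + 1) ↔ Even n := by simp [Nat.even_add_one]
  have h2 : ∀ i, Even (n + 1 + (i + 1) + 1) ↔ Even (n + i + 1) := by
    intro i
    rw [show n + 1 + (i + 1) + 1 = (n + i + 1) + 2 by ring]
    simp [Nat.even_add]
  simp [altProd, List.ofFn_succ, h1, h2]

/-- Exponents are fixed by the distance to the right end. A letter added on the left leaves them
alone; one added on the right flips them all, whence the pointwise inverse of `w`. -/
lemma altProd_snoc {n : ℕ} (w : Fin n → Γ) (a : Γ) :
    altProd (Fin.snoc w a : Fin (n + 1) → Γ) = altProd w⁻¹ * a := by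
  have h1 : ¬ Even (n + n + 1) := by simp [Nat.even_add_one]
  have h2 : ∀ i, Even (n + 1 + i + 1) ↔ ¬ Even (n + i + 1) := by
    intro i
    rw [show n + 1 + i + 1 = (n + i + 1) + 1 by ring, Nat.even_add_one]
  simp only [altProd, List.ofFn_succ', List.concat_eq_append, List.prod_append, Fin.snoc_castSucc,
    Fin.snoc_last, Fin.val_castSucc, Fin.val_last, List.prod_singleton, h2, h1, ite_not, if_false,
    Pi.inv_apply, inv_inv]

/-- The element by which `h_n` is multiplied to lengthen words by a letter on the left. -/
noncomputable def stepElem (Y : Finset Γ) (n : ℕ) : MonoidAlgebra ℂ Γ :=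
  if Even n then h Y else adjoint (h Y)

lemma stepElem_eq (Y : Finset Γ) (n : ℕ) :
    stepElem Y n = ∑ a ∈ Y, MonoidAlgebra.single (if Even n then a else a⁻¹) 1 := by
  unfold stepElem
  split_ifs
  · rfl
  · exact adjoint_h Y

lemma hSeq_one (Y : Finset Γ) : hSeq Y 1 = h Y := by
  simp [hSeq, sum_reducedWords_one, altProd, h]

/-- A new letter either differs from the first letter, giving a longer reduced word, or equals it
and cancels, leaving the tail. -/
lemma stepElem_mul_hSeq (Y : Finset Γ) (n : ℕ) :
    stepElem Y (n + 1) * hSeq Y (n + 1) = hSeq Y (n + 2) +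
      ∑ w ∈ reducedWords Y (n + 1), MonoidAlgebra.single (altProd (Fin.tail w)) 1 := by
  classical
  rw [stepElem_eq, hSeq, hSeq, sum_reducedWords_succ_succ, ← Finset.sum_add_distrib,
    Finset.mul_sum]
  refine Finset.sum_congr rfl fun w hw => ?_
  have h0 := (mem_reducedWords.1 hw).1 0
  rw [Finset.sum_mul, ← Finset.sum_erase_add _ _ h0]
  simp only [MonoidAlgebra.single_mul_single, mul_one, altProd_cons]
  congr 2
  conv_lhs => rw [← Fin.cons_self_tail w, altProd_cons]
  by_cases hn : Even n <;> simp [Nat.even_add_one, hn]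

lemma adjoint_h_mul_h {Y : Finset Γ} {q : ℕ} (hY : Y.card = q + 1) :
    adjoint (h Y) * h Y = hSeq Y 2 + (q + 1) • 1 := by
  have := stepElem_mul_hSeq Y 0
  rw [sum_reducedWords_one] at this
  simpa only [stepElem, zero_add, Nat.not_even_one, if_false, hSeq_one, altProd, List.ofFn_zero,
    List.prod_nil, Finset.sum_const, hY, ← MonoidAlgebra.one_def] using this

/-- Each word of length n+1 is the tail of exactly q words. The empty word is the tail of q+1, which
is why the lowest relations below carry different constants. -/
lemma stepElem_mul_hSeq_succ {Y : Finset Γ} {q : ℕ} (hY : Y.card = q + 1) (n : ℕ) :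
    stepElem Y (n + 2) * hSeq Y (n + 2) = hSeq Y (n + 3) + q • hSeq Y (n + 1) := by
  classical
  rw [stepElem_mul_hSeq, sum_reducedWords_succ_succ]
  congr 1
  rw [hSeq, Finset.smul_sum]
  refine Finset.sum_congr rfl fun w hw => ?_
  have h0 := (mem_reducedWords.1 hw).1 0
  simp only [Fin.tail_cons, Finset.sum_const, Finset.card_erase_of_mem h0, hY]
  rfl

lemma adjoint_h_mul_h_mul_hSeq_two {Y : Finset Γ} {q : ℕ} (hY : Y.card = q + 1) :
    adjoint (h Y) * h Y * hSeq Y 2 = hSeq Y 4 + (2 * q) • hSeq Y 2 + (q * (q + 1)) • 1 := by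
  have h1 := stepElem_mul_hSeq_succ hY 0
  have h2 := stepElem_mul_hSeq_succ hY 1
  have e3 : ¬ Even 3 := by decide
  simp only [stepElem, zero_add, even_two, if_true, Nat.reduceAdd, e3, if_false] at h1 h2
  rw [mul_assoc, h1, mul_add, h2, mul_smul_comm, hSeq_one, adjoint_h_mul_h hY]
  module

lemma adjoint_h_mul_h_mul_hSeq {Y : Finset Γ} {q : ℕ} (hY : Y.card = q + 1) (n : ℕ) :
    adjoint (h Y) * h Y * hSeq Y (2 * n + 4) =
      hSeq Y (2 * n + 6) + (2 * q) • hSeq Y (2 * n + 4) + q ^ 2 • hSeq Y (2 * n + 2) := by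
  have h1 := stepElem_mul_hSeq_succ hY (2 * n + 2)
  have h2 := stepElem_mul_hSeq_succ hY (2 * n + 3)
  have h3 := stepElem_mul_hSeq_succ hY (2 * n + 1)
  have e4 : Even (2 * n + 4) := ⟨n + 2, by ring⟩
  have e5 : ¬ Even (2 * n + 5) := by rw [Nat.even_add_one]; simpa using e4
  have e3 : ¬ Even (2 * n + 3) := by
    rw [Nat.even_add_one, not_not]; exact ⟨n + 1, by ring⟩
  simp only [stepElem, add_assoc, Nat.reduceAdd, e3, e4, e5, if_true, if_false] at h1 h2 h3
  rw [mul_assoc, h1, mul_add, h2, mul_smul_comm, h3]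
  module

open Polynomial in
/-- In the group ring, `h_{2n+4} - q h_{2n+2}` is the value of `Q_{n+2} - Q_{n+1}` at `h^* h`. -/
lemma hSeq_eq_aeval {Y : Finset Γ} {q : ℕ} (hY : Y.card = q + 1) (n : ℕ) :
    hSeq Y (2 * n + 4) - q • hSeq Y (2 * n + 2) =
      aeval (adjoint (h Y) * h Y) (chebyPoly q (n + 2) - chebyPoly q (n + 1)) := by
  set A := adjoint (h Y) * h Y with hA
  have hC : ∀ c : ℝ, ∀ p : ℝ[X], aeval A (C c * p) = c • aeval A p := by
    intro c p
    rw [← smul_eq_C_mul, map_smul]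
  have h2 : hSeq Y 2 = A - (q + 1 : ℝ) • 1 := by
    rw [hA, adjoint_h_mul_h hY]; module
  have h4 : hSeq Y 4 = A * hSeq Y 2 - (2 * q : ℝ) • hSeq Y 2 - (q * (q + 1) : ℝ) • 1 := by
    rw [hA, adjoint_h_mul_h_mul_hSeq_two hY]; module
  have hrec : ∀ n, hSeq Y (2 * n + 6) =
      A * hSeq Y (2 * n + 4) - (2 * q : ℝ) • hSeq Y (2 * n + 4) -
        (q ^ 2 : ℝ) • hSeq Y (2 * n + 2) := by
    intro n
    rw [hA, adjoint_h_mul_h_mul_hSeq hY n]; module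
  have hQ : ∀ n, aeval A (chebyPoly q (n + 2)) = A * aeval A (chebyPoly q (n + 1)) -
      (2 * q : ℝ) • aeval A (chebyPoly q (n + 1)) - (q ^ 2 : ℝ) • aeval A (chebyPoly q n) := by
    intro n
    rw [chebyPoly, map_sub, hC, sub_mul, map_sub, hC, map_mul, aeval_X]
  have hQ1 : aeval A (chebyPoly q 1) = A - (2 * q : ℝ) • 1 := by
    rw [chebyPoly, map_sub, aeval_X, aeval_C, Algebra.algebraMap_eq_smul_one]
  have hQ0 : aeval A (chebyPoly q 0) = (2 : ℝ) • 1 := by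
    rw [chebyPoly, map_ofNat, ← Algebra.algebraMap_eq_smul_one, map_ofNat]
  -- Both sides satisfy D_{n+2} = (A - 2q) D_{n+1} - q² D_n, so two base cases suffice. They absorb
  -- the exceptional constant q(q+1) in the relation for h_4.
  induction n using Nat.twoStepInduction with
  | zero =>
    rw [map_sub, hQ 0, zero_add, hQ0, hQ1, mul_zero, zero_add, zero_add, h4, h2]
    simp only [mul_sub, mul_smul_comm, mul_one]
    module
  | one =>
    have := hrec 0
    simp only [mul_zero, zero_add] at this
    rw [map_sub, hQ 1, hQ 0, zero_add, hQ0, hQ1, this, h4, h2]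
    simp only [mul_sub, mul_smul_comm, mul_one]
    module
  | more n ih1 ih2 =>
    rw [map_sub] at ih1 ih2 ⊢
    have e1 := congrArg (fun x => A * x) ih2
    simp only [mul_sub, mul_smul_comm] at e1
    have r1 := hrec (n + 1)
    have r2 := hrec n
    have s1 := hQ (n + 2)
    have s2 := hQ (n + 1)
    simp only [mul_add, add_assoc, Nat.reduceMul, Nat.reduceAdd, mul_one]
      at r1 r2 s1 s2 e1 ih1 ih2 ⊢
    linear_combination (norm := module) r1 - (q : ℝ) • r2 - s1 + s2 + e1 - (2 * q : ℝ) • ih2 -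
      (q ^ 2 : ℝ) • ih1

end GroupCogrowth

namespace GroupCogrowth

/-! ### Closed reduced words versus closed cyclically reduced words. -/

section Words

variable {Γ : Type*}

lemma snoc_mem_reducedWords {Y : Finset Γ} {n : ℕ} {a : Γ} {w : Fin (n + 1) → Γ} :
    (Fin.snoc w a : Fin (n + 2) → Γ) ∈ reducedWords Y (n + 2) ↔
      a ∈ Y ∧ a ≠ w (Fin.last n) ∧ w ∈ reducedWords Y (n + 1) := by
  simp only [mem_reducedWords]
  constructor
  · rintro ⟨h1, h2⟩
    refine ⟨by simpa using h1 (Fin.last _), ?_, fun i => by simpa using h1 i.castSucc,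
      fun i j hij => ?_⟩
    · have := h2 (Fin.last n).castSucc (Fin.last _) (by simp)
      simpa using this.symm
    · have := h2 i.castSucc j.castSucc (by simp [hij])
      simpa using this
  · rintro ⟨h1, h2, h3, h4⟩
    refine ⟨fun i => ?_, fun i j hij => ?_⟩
    · refine Fin.lastCases ?_ (fun i => ?_) i
      · simpa using h1
      · simpa using h3 i
    · revert hij
      refine Fin.lastCases ?_ (fun i => ?_) i
      · intro hij
        have := j.2
        simp only [Fin.val_last] at hij
        omega
      · refine Fin.lastCases ?_ (fun j => ?_) j
        · intro hij
          obtain rfl : i = Fin.last n := by ext; simpa using hij.symm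
          simpa using h2.symm
        · intro hij
          simpa using h4 i j (by simpa using hij)

open Classical in
/-- Removing the last letter of a reduced word. -/
lemma sum_reducedWords_succ_succ' {M : Type*} [AddCommMonoid M] (Y : Finset Γ) (n : ℕ)
    (f : (Fin (n + 2) → Γ) → M) :
    ∑ s ∈ reducedWords Y (n + 2), f s =
      ∑ w ∈ reducedWords Y (n + 1), ∑ a ∈ Y.erase (w (Fin.last n)), f (Fin.snoc w a) := by
  rw [Finset.sum_sigma']
  symm
  refine Finset.sum_bij' (fun p _ => Fin.snoc p.1 p.2)
    (fun s _ => ⟨fun i => s i.castSucc, s (Fin.last _)⟩) ?_ ?_ ?_ ?_ ?_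
  · rintro ⟨w, a⟩ h
    simp only [Finset.mem_sigma, Finset.mem_erase] at h
    exact snoc_mem_reducedWords.2 ⟨h.2.2, h.2.1, h.1⟩
  · intro s h
    rw [← Fin.snoc_init_self s, snoc_mem_reducedWords] at h
    simp only [Finset.mem_sigma, Finset.mem_erase]
    exact ⟨h.2.2, h.2.1, h.1⟩
  · rintro ⟨w, a⟩ _
    simp
  · intro s _
    exact Fin.snoc_init_self s
  · simp

lemma mem_cyclicWords {Y : Finset Γ} {n : ℕ} {s : Fin (n + 1) → Γ} :
    s ∈ cyclicWords Y (n + 1) ↔ s ∈ reducedWords Y (n + 1) ∧ s (Fin.last n) ≠ s 0 := by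
  simp only [cyclicWords, Finset.mem_filter, and_congr_right_iff]
  refine fun _ => ⟨fun h => h 0 (Fin.last n) (by simp) (by simp), fun h i j hi hj => ?_⟩
  obtain rfl : i = 0 := by ext; simpa using hi
  obtain rfl : j = Fin.last n := by ext; simpa using hj
  exact h

/-- Addition in `Fin (n + 1)` wraps around, so this form of the condition is visibly invariant under
rotation. -/
lemma mem_cyclicWords_iff_forall {Y : Finset Γ} {n : ℕ} {s : Fin (n + 1) → Γ} :
    s ∈ cyclicWords Y (n + 1) ↔ (∀ i, s i ∈ Y) ∧ ∀ i, s i ≠ s (i + 1) := by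
  rw [mem_cyclicWords, mem_reducedWords, and_assoc, and_congr_right_iff]
  refine fun _ => ⟨fun ⟨h1, h2⟩ i => ?_, fun h => ⟨fun i j hij => ?_, ?_⟩⟩
  · rcases eq_or_ne i (Fin.last n) with rfl | hi
    · simpa using h2
    · exact h1 _ _ (Fin.val_add_one_of_lt (Fin.lt_last_iff_ne_last.2 hi))
  · have hi : i < Fin.last n := by
      rw [Fin.lt_def, Fin.val_last]; omega
    have : j = i + 1 := by
      ext; rw [Fin.val_add_one_of_lt hi, hij]
    rw [this]
    exact h i
  · simpa using h (Fin.last n)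

-- Counts the letters that may be placed next to both `a` and `b`. The correction for a ≠ b is the
-- source of the subtracted terms in the recursions for η_n and ‖h_n‖₂².
open Classical in
lemma card_erase_inter_erase {Y : Finset Γ} {q : ℕ} (hY : Y.card = q + 1) {a b : Γ}
    (ha : a ∈ Y) (hb : b ∈ Y) :
    (((Y.erase a ∩ Y.erase b).card : ℕ) : ℝ) = q - if a ≠ b then 1 else 0 := by
  split_ifs with hab
  · have : Y.erase a ∩ Y.erase b = (Y.erase a).erase b := by
      ext; simp; tauto
    rw [this, Finset.card_erase_of_mem (by simp [hb, Ne.symm hab]), Finset.card_erase_of_mem ha, hY]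
    have : 1 < Y.card := Finset.one_lt_card.2 ⟨a, ha, b, hb, hab⟩
    rw [Nat.add_sub_cancel, Nat.cast_sub (by omega), Nat.cast_one]
  · obtain rfl : a = b := by simpa using hab
    rw [Finset.inter_self, Finset.card_erase_of_mem ha, hY]
    simp

end Words

variable {Γ : Type*} [Group Γ]

open Classical in
lemma inv_mem_reducedWords {Y : Finset Γ} {n : ℕ} {s : Fin n → Γ} :
    s⁻¹ ∈ reducedWords Y⁻¹ n ↔ s ∈ reducedWords Y n := by
  simp [mem_reducedWords, Finset.mem_inv']

open Classical in
lemma eta_eq_sum (Y : Finset Γ) (n : ℕ) :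
    eta Y n = ∑ s ∈ reducedWords Y (2 * n), if altProd s = 1 then 1 else 0 :=
  reTrace_sum_single _ _

open Classical in
lemma zeta_eq_sum (Y : Finset Γ) (n : ℕ) :
    zeta Y n = ∑ s ∈ cyclicWords Y (2 * n), if altProd s = 1 then 1 else 0 :=
  reTrace_sum_single _ _

lemma zeta_nonneg (Y : Finset Γ) (n : ℕ) : 0 ≤ zeta Y n := by
  classical
  rw [zeta_eq_sum]
  exact Finset.sum_nonneg fun _ _ => by split_ifs <;> norm_num

lemma zeta_le_eta (Y : Finset Γ) (n : ℕ) : zeta Y n ≤ eta Y n := by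
  classical
  rw [zeta_eq_sum, eta_eq_sum]
  refine Finset.sum_le_sum_of_subset_of_nonneg (Finset.filter_subset _ _) fun _ _ _ => ?_
  split_ifs <;> norm_num

lemma eta_one (Y : Finset Γ) : eta Y 1 = zeta Y 1 := by
  classical
  rw [zeta_eq_sum, eta_eq_sum]
  refine Finset.sum_congr (Finset.ext fun s => ?_) fun _ _ => rfl
  rw [mem_cyclicWords (n := 1)]
  refine ⟨fun h => ⟨h, ?_⟩, fun h => h.1⟩
  exact ((mem_reducedWords.1 h).2 0 1 rfl).symm

open Classical in
/-- Rotating a cyclically reduced word conjugates its alternating product. -/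
lemma zeta_inv (Y : Finset Γ) (n : ℕ) : zeta Y⁻¹ (n + 1) = zeta Y (n + 1) := by
  classical
  rw [zeta_eq_sum, zeta_eq_sum, show 2 * (n + 1) = (2 * n + 1) + 1 by ring]
  symm
  -- Rotation by one place reverses the exponent pattern, and inverting the letters restores it. The
  -- first factor of the product thereby moves to the end.
  refine Finset.sum_bij' (fun s _ i => (s (i + 1))⁻¹) (fun s _ i => (s (i - 1))⁻¹) ?_ ?_ ?_ ?_ ?_
  · intro s hs
    rw [mem_cyclicWords_iff_forall] at hs ⊢
    refine ⟨fun i => ?_, fun i => ?_⟩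
    · simpa [Finset.mem_inv'] using hs.1 (i + 1)
    · simpa using hs.2 (i + 1)
  · intro s hs
    rw [mem_cyclicWords_iff_forall] at hs ⊢
    refine ⟨fun i => ?_, fun i => ?_⟩
    · simpa [Finset.mem_inv'] using hs.1 (i - 1)
    · simpa using hs.2 (i - 1)
  · intro s _
    funext i
    simp
  · intro s _
    funext i
    simp
  · intro s _
    have h1 : s = Fin.cons (s 0) (Fin.tail s) := (Fin.cons_self_tail s).symm
    have h2 : (fun i => (s (i + 1))⁻¹) =
        (Fin.snoc (Fin.tail s)⁻¹ (s 0)⁻¹ : Fin (2 * n + 1 + 1) → Γ) := by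
      funext i
      refine Fin.lastCases ?_ (fun i => ?_) i
      · simp
      · simp [Fin.tail, Fin.coeSucc_eq_succ]
    have h3 : ¬ Even (2 * n + 1) := by simp
    rw [h2, altProd_snoc, inv_inv]
    conv_lhs => rw [h1, altProd_cons, if_neg h3]
    refine if_congr ?_ rfl rfl
    rw [mul_eq_one_iff_eq_inv, mul_eq_one_iff_eq_inv, eq_comm, inv_eq_iff_eq_inv, inv_inv]

open Classical in
/-- Words with equal first and last letter are conjugates of shorter words. -/
lemma eta_succ_succ_inv {Y : Finset Γ} {q : ℕ} (hY : Y.card = q + 1) (n : ℕ) :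
    eta Y (n + 2) = zeta Y (n + 2) + (q * eta Y⁻¹ (n + 1) - zeta Y⁻¹ (n + 1)) := by
  classical
  have e3 : 2 * (n + 2) = (2 * n + 1) + 1 + 2 := by ring
  have e1 : 2 * (n + 1) = (2 * n + 1) + 1 := by ring
  have hodd : ¬ Even (2 * n + 1 + 1 + 1) := by simp [Nat.even_add_one]
  have hinv : ∀ f : (Fin (2 * n + 1 + 1) → Γ) → ℝ,
      ∑ v ∈ reducedWords Y⁻¹ (2 * n + 1 + 1), f v =
        ∑ v ∈ reducedWords Y (2 * n + 1 + 1), f v⁻¹ := by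
    intro f
    refine Finset.sum_bij' (fun v _ => v⁻¹) (fun v _ => v⁻¹) ?_ ?_ ?_ ?_ ?_
    · intro v hv
      rwa [← inv_mem_reducedWords, inv_inv]
    · intro v hv
      rwa [inv_mem_reducedWords]
    · simp
    · simp
    · simp
  have hz : ∀ (Z : Finset Γ) (m : ℕ),
      ∑ s ∈ cyclicWords Z (m + 1), (if altProd s = 1 then (1 : ℝ) else 0) =
      ∑ s ∈ reducedWords Z (m + 1), if altProd s = 1 ∧ s (Fin.last m) ≠ s 0 then 1 else 0 := by
    intro Z m
    have : cyclicWords Z (m + 1) = (reducedWords Z (m + 1)).filter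
        fun s => s (Fin.last m) ≠ s 0 := by
      ext s; rw [mem_cyclicWords, Finset.mem_filter]
    rw [this, Finset.sum_filter]
    refine Finset.sum_congr rfl fun s _ => ?_
    split_ifs <;> simp_all
  -- If the outer letters agree, the product is a⁻¹ p a and is trivial exactly when p is. The inner
  -- word starts with exponent +1, so it is a word over `Y⁻¹`. The bracket is the number of
  -- admissible outer letters a.
  have key : ∑ s ∈ reducedWords Y (2 * n + 1 + 1 + 2),
      (if altProd s = 1 ∧ s (Fin.last _) = s 0 then (1 : ℝ) else 0) =
      ∑ v ∈ reducedWords Y⁻¹ (2 * n + 1 + 1),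
        ((q : ℝ) - if v (Fin.last _) ≠ v 0 then 1 else 0) * if altProd v = 1 then 1 else 0 := by
    rw [sum_reducedWords_succ_succ, hinv, sum_reducedWords_succ_succ']
    refine Finset.sum_congr rfl fun v hv => ?_
    have hl := (mem_reducedWords.1 hv).1 (Fin.last _)
    have h0 := (mem_reducedWords.1 hv).1 0
    have : ∀ a b : Γ, (altProd (Fin.cons b (Fin.snoc v a) : Fin (2 * n + 1 + 1 + 2) → Γ) = 1 ∧
        (Fin.cons b (Fin.snoc v a) : Fin (2 * n + 1 + 1 + 2) → Γ) (Fin.last _) =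
        (Fin.cons b (Fin.snoc v a) : Fin (2 * n + 1 + 1 + 2) → Γ) 0) ↔ a = b ∧ altProd v⁻¹ = 1 := by
      intro a b
      rw [altProd_cons, if_neg hodd, altProd_snoc, ← Fin.succ_last, Fin.cons_succ, Fin.snoc_last,
        Fin.cons_zero]
      constructor
      · rintro ⟨h1, rfl⟩
        refine ⟨rfl, ?_⟩
        rwa [inv_mul_eq_one, right_eq_mul] at h1
      · rintro ⟨rfl, h1⟩
        simp [h1]
    have h0' : ∀ a : Γ, (Fin.snoc v a : Fin (2 * n + 1 + 2) → Γ) 0 = v 0 := by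
      intro a
      rw [← Fin.castSucc_zero, Fin.snoc_castSucc]
    simp only [this, h0', Pi.inv_apply, ne_eq, inv_inj]
    rw [← card_erase_inter_erase hY hl h0, ← Finset.filter_mem_eq_inter, Finset.card_filter]
    push_cast
    rw [Finset.sum_mul]
    refine Finset.sum_congr rfl fun a _ => ?_
    by_cases h1 : altProd v⁻¹ = 1
    · simp [h1]
    · simp [h1]
  rw [eta_eq_sum, eta_eq_sum, zeta_eq_sum, zeta_eq_sum, e3, e1, hz, hz]
  rw [Finset.mul_sum, ← Finset.sum_sub_distrib]
  have key' : ∑ s ∈ reducedWords Y (2 * n + 1 + 1 + 2), (if altProd s = 1 then (1 : ℝ) else 0) =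
      ∑ s ∈ reducedWords Y (2 * n + 1 + 1 + 2),
        (if altProd s = 1 ∧ s (Fin.last _) ≠ s 0 then (1 : ℝ) else 0) +
      ∑ s ∈ reducedWords Y (2 * n + 1 + 1 + 2),
        (if altProd s = 1 ∧ s (Fin.last _) = s 0 then (1 : ℝ) else 0) := by
    rw [← Finset.sum_add_distrib]
    refine Finset.sum_congr rfl fun s _ => ?_
    split_ifs <;> simp_all
  rw [key', key]
  congr 1
  refine Finset.sum_congr rfl fun s _ => ?_
  split_ifs <;> simp_all

/-- The recursion linking closed reduced words and closed cyclically reduced words. -/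
lemma eta_succ {Y : Finset Γ} {q : ℕ} (hY : Y.card = q + 1) (n : ℕ) :
    eta Y (n + 2) = zeta Y (n + 2) - zeta Y (n + 1) + q * eta Y (n + 1) := by
  classical
  have hY' : Y⁻¹.card = q + 1 := by rwa [Finset.card_inv]
  -- `Y` and `Y⁻¹` have the same ζ, and each η is computed from the other set's predecessor, so
  -- equality propagates from n = 1.
  have hinv : ∀ n, eta Y⁻¹ (n + 1) = eta Y (n + 1) := by
    intro n
    induction n with
    | zero => rw [zero_add, eta_one, eta_one]; exact zeta_inv Y 0
    | succ n ih =>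
      rw [eta_succ_succ_inv hY, eta_succ_succ_inv hY', inv_inv, ih,
        zeta_inv Y (n + 1), zeta_inv Y n]
  rw [eta_succ_succ_inv hY, hinv, zeta_inv]
  ring

end GroupCogrowth

namespace GroupCogrowth

variable {Γ : Type*} [Group Γ]

/-! ### Pairs of reduced words with equal alternating products -/

open Classical in
lemma norm2_hSeq_sq (Y : Finset Γ) (n : ℕ) :
    norm2 (hSeq Y n) ^ 2 = ∑ u ∈ reducedWords Y n, ∑ v ∈ reducedWords Y n,
      if altProd u = altProd v then (1 : ℝ) else 0 := by
  have h1 : (trace (adjoint (hSeq Y n) * hSeq Y n)).re = ∑ u ∈ reducedWords Y n,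
      ∑ v ∈ reducedWords Y n, if altProd u = altProd v then (1 : ℝ) else 0 := by
    rw [← reTrace_apply, hSeq, adjoint_sum, Finset.sum_mul, map_sum]
    refine Finset.sum_congr rfl fun u _ => ?_
    rw [Finset.mul_sum]
    simp only [adjoint_single, map_one, MonoidAlgebra.single_mul_single, mul_one]
    rw [reTrace_sum_single]
    simp only [inv_mul_eq_one]
  rw [norm2, Real.sq_sqrt, h1]
  rw [h1]
  exact Finset.sum_nonneg fun _ _ => Finset.sum_nonneg fun _ _ => by split_ifs <;> norm_num

lemma altProd_append_rev {n : ℕ} (u v : Fin n → Γ) :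
    altProd (Fin.append (u ∘ Fin.rev) v) = (altProd u)⁻¹ * altProd v := by
  have h1 : ∀ i, Even (n + n + i + 1) ↔ ¬ Even i := by
    intro i
    rw [Nat.even_add_one, Nat.even_add]
    simp
  have h2 : (List.ofFn fun i : Fin n => if Even (i : ℕ) then (u i.rev)⁻¹ else u i.rev) =
      ((List.ofFn fun i : Fin n => if Even (n + i + 1) then u i else (u i)⁻¹).map
        (·⁻¹)).reverse := by
    rw [List.map_ofFn]
    apply List.ext_getElem
    · simp
    · intro k hk hk'
      simp only [List.length_ofFn] at hk
      simp only [List.getElem_ofFn, List.getElem_reverse, List.length_ofFn, Function.comp]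
      have e : Fin.rev ⟨k, hk⟩ = ⟨n - 1 - k, by omega⟩ := by
        ext; simp [Fin.val_rev]; omega
      have e2 : Even (n + (n - 1 - k) + 1) ↔ Even k := by
        have : n + (n - 1 - k) + 1 + k = 2 * n := by omega
        have h : Even (n + (n - 1 - k) + 1 + k) := by rw [this]; exact even_two_mul n
        rwa [Nat.even_add] at h
      simp only [e, e2]
      split_ifs <;> simp
  rw [altProd, altProd, altProd, List.prod_inv_reverse, ← h2, List.ofFn_add, List.prod_append]
  congr 2
  · congr 1
    funext i
    have : Fin.append (u ∘ Fin.rev) v (Fin.castLE (Nat.le_add_right n n) i) = u i.rev :=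
      Fin.append_left _ _ _
    rw [this, Fin.val_castLE, if_congr (h1 i) rfl rfl, ite_not]
  · congr 1
    funext i
    have e : Even (n + n + (n + (i : ℕ)) + 1) ↔ Even (n + i + 1) := by
      rw [h1, ← Nat.even_add_one]
    rw [Fin.append_right, Fin.val_natAdd, if_congr e rfl rfl]

-- A closed word is cut in the middle and its left half reversed. Closedness becomes equality of the
-- two products, and reducedness at the cut becomes distinctness of the first letters.
open Classical in
lemma eta_eq_sum_pairs (Y : Finset Γ) (n : ℕ) :
    eta Y (n + 1) = ∑ u ∈ reducedWords Y (n + 1), ∑ v ∈ reducedWords Y (n + 1),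
      if altProd u = altProd v ∧ u 0 ≠ v 0 then (1 : ℝ) else 0 := by
  rw [eta_eq_sum, two_mul, ← Finset.sum_product']
  have : ∀ p : (Fin (n + 1) → Γ) × (Fin (n + 1) → Γ),
      (if altProd p.1 = altProd p.2 ∧ p.1 0 ≠ p.2 0 then (1 : ℝ) else 0) =
      if p.1 0 ≠ p.2 0 then (if altProd p.1 = altProd p.2 then (1 : ℝ) else 0) else 0 := by
    intro p
    split_ifs <;> simp_all
  simp only [this]
  conv_rhs => rw [← Finset.sum_filter]
  refine Finset.sum_bij'
    (fun s _ => (fun i => s (Fin.castAdd _ (Fin.rev i)), fun i => s (Fin.natAdd _ i)))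
    (fun p _ => Fin.append (p.1 ∘ Fin.rev) p.2) ?_ ?_ ?_ ?_ ?_
  · intro s hs
    rw [mem_reducedWords] at hs
    simp only [Finset.mem_filter, Finset.mem_product, mem_reducedWords]
    refine ⟨⟨⟨fun i => hs.1 _, fun i j hij => (hs.2 _ _ ?_).symm⟩,
      ⟨fun i => hs.1 _, fun i j hij => hs.2 _ _ ?_⟩⟩, hs.2 _ _ ?_⟩
    · simp [Fin.val_rev]; omega
    · simp; omega
    · simp
  · rintro ⟨u, v⟩ h
    simp only [Finset.mem_filter, Finset.mem_product, mem_reducedWords] at h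
    obtain ⟨⟨⟨h1, h2⟩, h3, h4⟩, h5⟩ := h
    rw [mem_reducedWords]
    refine ⟨fun i => ?_, fun i j hij => ?_⟩
    · refine Fin.addCases (fun i => ?_) (fun i => ?_) i
      · simpa using h1 _
      · rw [Fin.append_right]; exact h3 _
    · revert hij
      refine Fin.addCases (fun i => ?_) (fun i => ?_) i <;>
      refine Fin.addCases (fun j => ?_) (fun j => ?_) j
      · intro hij
        simp only [Fin.append_left, Function.comp]
        refine (h2 _ _ ?_).symm
        simp only [Fin.val_castAdd, Fin.val_rev] at hij ⊢
        omega
      · intro hij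
        simp only [Fin.append_left, Fin.append_right, Function.comp]
        simp only [Fin.val_castAdd, Fin.val_natAdd] at hij
        have hi := i.2
        have hj := j.2
        have e1 : i.rev = 0 := by ext; simp [Fin.val_rev]; omega
        have e2 : j = 0 := by ext; rw [Fin.val_zero]; omega
        rwa [e1, e2]
      · intro hij
        simp only [Fin.val_castAdd, Fin.val_natAdd] at hij
        omega
      · intro hij
        simp only [Fin.append_right]
        refine h4 _ _ ?_
        simp only [Fin.val_natAdd] at hij
        omega
  · intro s _
    funext i
    refine Fin.addCases (fun i => ?_) (fun i => ?_) i <;>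
      simp only [Fin.append_left, Fin.append_right, Function.comp, Fin.rev_rev]
  · rintro ⟨u, v⟩ _
    simp only [Fin.append_left, Fin.append_right, Function.comp, Fin.rev_rev]
  · intro s hs
    have : s = Fin.append ((fun i => s (Fin.castAdd _ (Fin.rev i))) ∘ Fin.rev)
        (fun i => s (Fin.natAdd _ i)) := by
      funext i
      refine Fin.addCases (fun i => ?_) (fun i => ?_) i <;>
        simp only [Fin.append_left, Fin.append_right, Function.comp, Fin.rev_rev]
    conv_lhs => rw [this, altProd_append_rev]
    simp only [inv_mul_eq_one]

/-- The recursion for the number of pairs of reduced words with equal alternating product. -/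
lemma norm2_hSeq_sq_succ {Y : Finset Γ} {q : ℕ} (hY : Y.card = q + 1) (n : ℕ) :
    norm2 (hSeq Y (n + 2)) ^ 2 =
      eta Y (n + 2) - eta Y (n + 1) + q * norm2 (hSeq Y (n + 1)) ^ 2 := by
  classical
  -- A common first letter cancels; the bracket counts the letters that can precede both shorter
  -- words.
  have key : ∑ u ∈ reducedWords Y (n + 2), ∑ v ∈ reducedWords Y (n + 2),
      (if altProd u = altProd v ∧ u 0 = v 0 then (1 : ℝ) else 0) =
      ∑ u ∈ reducedWords Y (n + 1), ∑ v ∈ reducedWords Y (n + 1),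
        ((q : ℝ) - if u 0 ≠ v 0 then 1 else 0) * if altProd u = altProd v then 1 else 0 := by
    rw [sum_reducedWords_succ_succ]
    refine Finset.sum_congr rfl fun u hu => ?_
    rw [Finset.sum_congr rfl fun a _ => sum_reducedWords_succ_succ Y n _, Finset.sum_comm]
    refine Finset.sum_congr rfl fun v hv => ?_
    have hu0 := (mem_reducedWords.1 hu).1 0
    have hv0 := (mem_reducedWords.1 hv).1 0
    have : ∀ a b : Γ, (altProd (Fin.cons a u : Fin (n + 2) → Γ) =
        altProd (Fin.cons b v : Fin (n + 2) → Γ) ∧ (Fin.cons a u : Fin (n + 2) → Γ) 0 =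
        (Fin.cons b v : Fin (n + 2) → Γ) 0) ↔ a = b ∧ altProd u = altProd v := by
      intro a b
      rw [altProd_cons, altProd_cons, Fin.cons_zero, Fin.cons_zero]
      constructor
      · rintro ⟨h1, rfl⟩
        exact ⟨rfl, mul_left_cancel h1⟩
      · rintro ⟨rfl, h1⟩
        simp [h1]
    simp only [this]
    rw [← card_erase_inter_erase hY hu0 hv0, ← Finset.filter_mem_eq_inter, Finset.card_filter]
    push_cast
    rw [Finset.sum_mul]
    refine Finset.sum_congr rfl fun a _ => ?_
    by_cases h1 : altProd u = altProd v
    · simp [h1]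
    · simp [h1]
  have split : norm2 (hSeq Y (n + 2)) ^ 2 = eta Y (n + 2) +
      ∑ u ∈ reducedWords Y (n + 2), ∑ v ∈ reducedWords Y (n + 2),
        (if altProd u = altProd v ∧ u 0 = v 0 then (1 : ℝ) else 0) := by
    rw [norm2_hSeq_sq, eta_eq_sum_pairs, ← Finset.sum_add_distrib]
    refine Finset.sum_congr rfl fun u _ => ?_
    rw [← Finset.sum_add_distrib]
    refine Finset.sum_congr rfl fun v _ => ?_
    split_ifs <;> simp_all
  have expand : ∑ u ∈ reducedWords Y (n + 1), ∑ v ∈ reducedWords Y (n + 1),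
        ((q : ℝ) - if u 0 ≠ v 0 then 1 else 0) * (if altProd u = altProd v then 1 else 0) =
      q * norm2 (hSeq Y (n + 1)) ^ 2 - eta Y (n + 1) := by
    rw [norm2_hSeq_sq, eta_eq_sum_pairs, Finset.mul_sum, ← Finset.sum_sub_distrib]
    refine Finset.sum_congr rfl fun u _ => ?_
    rw [Finset.mul_sum, ← Finset.sum_sub_distrib]
    refine Finset.sum_congr rfl fun v _ => ?_
    split_ifs <;> simp_all
  rw [split, key, expand]
  ring

lemma norm2_hSeq_one_sq {Y : Finset Γ} {q : ℕ} (hY : Y.card = q + 1) :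
    norm2 (hSeq Y 1) ^ 2 = eta Y 1 + (q + 1) := by
  classical
  have h1 : ∑ u ∈ reducedWords Y 1, ∑ v ∈ reducedWords Y 1,
      (if altProd u = altProd v ∧ u 0 = v 0 then (1 : ℝ) else 0) = q + 1 := by
    have : ∀ a b : Γ, (altProd (fun _ : Fin 1 => a) = altProd (fun _ : Fin 1 => b) ∧ a = b) ↔
        a = b := fun a b => and_iff_right_of_imp (by rintro rfl; rfl)
    simp only [sum_reducedWords_one, this, Finset.sum_ite_eq]
    simp [hY]
  rw [← h1, norm2_hSeq_sq, eta_eq_sum_pairs, ← Finset.sum_add_distrib]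
  refine Finset.sum_congr rfl fun u _ => ?_
  rw [← Finset.sum_add_distrib]
  refine Finset.sum_congr rfl fun v _ => ?_
  split_ifs <;> simp_all

lemma norm2_hSeq_sq_le {Y : Finset Γ} {q : ℕ} (hY : Y.card = q + 1) (n : ℕ) :
    norm2 (hSeq Y (n + 1)) ^ 2 ≤ (q + 1) ^ 2 * ((q : ℝ) ^ 2) ^ n := by
  classical
  rw [norm2_hSeq_sq]
  have : ∀ u ∈ reducedWords Y (n + 1), ∀ v ∈ reducedWords Y (n + 1),
      (if altProd u = altProd v then (1 : ℝ) else 0) ≤ 1 := fun u _ v _ => by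
    split_ifs <;> norm_num
  refine (Finset.sum_le_sum fun u hu => Finset.sum_le_sum (this u hu)).trans (le_of_eq ?_)
  simp only [Finset.sum_const, card_reducedWords hY, nsmul_eq_mul]
  push_cast
  ring

lemma xi_one {Y : Finset Γ} {q : ℕ} (hY : Y.card = q + 1) : xi Y q 1 = eta Y 1 := by
  rw [xi, norm2_hSeq_one_sq hY]
  simp

/-- The term (q+1)q^{n-1} counts the diagonal pairs and is multiplied by q at each step, so
subtracting it does not disturb the recursion. -/
lemma xi_succ {Y : Finset Γ} {q : ℕ} (hY : Y.card = q + 1) (n : ℕ) :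
    xi Y q (n + 2) = eta Y (n + 2) - eta Y (n + 1) + q * xi Y q (n + 1) := by
  rw [xi, xi, norm2_hSeq_sq_succ hY]
  simp only [Nat.add_succ_sub_one]
  ring

/-- By `xi_succ` the excess is qξ_{n+1} - η_{n+1}, nonnegative by induction. -/
lemma eta_le_xi {Y : Finset Γ} {q : ℕ} (hq : 1 ≤ q) (hY : Y.card = q + 1) (n : ℕ) :
    eta Y (n + 1) ≤ xi Y q (n + 1) := by
  induction n with
  | zero => exact (xi_one hY).ge
  | succ n ih =>
    have hq' : (1 : ℝ) ≤ q := by exact_mod_cast hq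
    have := (zeta_nonneg Y (n + 1)).trans (zeta_le_eta Y (n + 1))
    rw [xi_succ hY]
    nlinarith

/-- The numbers `ζ_n` as moments of the polynomials `Q_n`. -/
lemma zeta_eq {Y : Finset Γ} {q : ℕ} (hY : Y.card = q + 1) (n : ℕ) :
    zeta Y (n + 1) =
      reTrace (Polynomial.aeval (adjoint (h Y) * h Y) (chebyPoly q (n + 1))) + (q - 1) := by
  induction n with
  | zero =>
    rw [zero_add, ← eta_one, eta, ← reTrace_apply, mul_one, chebyPoly, map_sub, Polynomial.aeval_X,
      Polynomial.aeval_C, Algebra.algebraMap_eq_smul_one, adjoint_h_mul_h hY, map_sub, map_smul,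
      map_add, map_nsmul, reTrace_one]
    simp
    ring
  | succ n ih =>
    -- The increments of ζ and of τ(Q(A)) both equal η_{n+2} - qη_{n+1}. Their difference therefore
    -- keeps its initial value q - 1.
    have h1 := congrArg reTrace (hSeq_eq_aeval hY n)
    simp only [map_sub, map_nsmul] at h1
    have h2 : eta Y (n + 2) = reTrace (hSeq Y (2 * n + 4)) := rfl
    have h3 : eta Y (n + 1) = reTrace (hSeq Y (2 * n + 2)) := rfl
    have h4 := eta_succ hY n
    rw [← h2, ← h3, nsmul_eq_mul] at h1
    change zeta Y (n + 2) = _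
    linarith

end GroupCogrowth

namespace GroupCogrowth

/-! ### Polynomials of positive operators -/

/-- A real polynomial that is nonnegative on `[0, M]` is nonnegative at every positive operator of
norm at most `M`. -/
lemma aeval_nonneg {H : Type*} [NormedAddCommGroup H] [InnerProductSpace ℂ H]
    [CompleteSpace H] {T : H →L[ℂ] H} (hT : 0 ≤ T) {M : ℝ} (hM : ‖T‖ ≤ M) {p : Polynomial ℝ}
    (hp : ∀ x, 0 ≤ x → x ≤ M → 0 ≤ p.eval x) : 0 ≤ Polynomial.aeval T p := by
  rw [← cfc_polynomial p T hT.isSelfAdjoint]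
  refine cfc_nonneg fun x hx => hp x (spectrum_nonneg_of_nonneg hT hx) ?_
  refine ((le_abs_self x).trans (spectrum.norm_le_norm_mul_of_mem hx)).trans (le_trans ?_ hM)
  exact mul_le_of_le_one_right (norm_nonneg _) ContinuousLinearMap.norm_id_le

lemma re_inner_nonneg {H : Type*} [NormedAddCommGroup H] [InnerProductSpace ℂ H]
    [CompleteSpace H] {T : H →L[ℂ] H} (hT : 0 ≤ T) (f : H) : 0 ≤ (inner ℂ f (T f)).re :=
  ((ContinuousLinearMap.nonneg_iff_isPositive _).1 hT).re_inner_nonneg_right f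

/-! ### The left regular representation -/

/-- The Hilbert space `ℓ²(Γ)`. -/
def EllTwo (Γ : Type*) : Type _ := lp (fun _ : Γ => ℂ) 2

namespace EllTwo

variable {Γ : Type*}

noncomputable instance : NormedAddCommGroup (EllTwo Γ) :=
  inferInstanceAs (NormedAddCommGroup (lp (fun _ : Γ => ℂ) 2))

noncomputable instance : InnerProductSpace ℂ (EllTwo Γ) :=
  inferInstanceAs (InnerProductSpace ℂ (lp (fun _ : Γ => ℂ) 2))

instance : CompleteSpace (EllTwo Γ) :=
  inferInstanceAs (CompleteSpace (lp (fun _ : Γ => ℂ) 2))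

/-- The coordinates of a vector in `ℓ²(Γ)`. -/
def coords (f : EllTwo Γ) : Γ → ℂ := f.1

instance : CoeFun (EllTwo Γ) fun _ => Γ → ℂ := ⟨coords⟩

@[ext]
lemma ext {f g : EllTwo Γ} (hfg : ∀ x, f x = g x) : f = g := Subtype.ext (funext hfg)

lemma hasSum_norm_sq (f : EllTwo Γ) : HasSum (fun x => ‖f x‖ ^ 2) (‖f‖ ^ 2) := by
  have := lp.hasSum_norm (p := 2) (E := fun _ : Γ => ℂ) (by norm_num) f
  simp only [ENNReal.toReal_ofNat, Real.rpow_ofNat] at this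
  exact this

/-- The vector with the given square summable coordinates. -/
def mk (f : Γ → ℂ) (hf : Summable fun x => ‖f x‖ ^ 2) : EllTwo Γ :=
  ⟨f, (memℓp_gen_iff (by norm_num)).2 (by simpa using hf)⟩

@[simp] lemma add_apply (f g : EllTwo Γ) (x : Γ) : (f + g) x = f x + g x := rfl

@[simp] lemma sub_apply (f g : EllTwo Γ) (x : Γ) : (f - g) x = f x - g x := rfl

@[simp] lemma smul_apply (c : ℂ) (f : EllTwo Γ) (x : Γ) : (c • f) x = c * f x := rfl

lemma hasSum_inner (f g : EllTwo Γ) :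
    HasSum (fun x => (starRingEnd ℂ) (f x) * g x) (inner ℂ f g) := by
  have := lp.hasSum_inner (𝕜 := ℂ) (G := fun _ : Γ => ℂ) f g
  simp only [RCLike.inner_apply'] at this
  exact this

open Classical in
/-- The unit vector at `x`. -/
noncomputable def delta (x : Γ) : EllTwo Γ :=
  mk (Pi.single x 1) (summable_of_hasFiniteSupport <| (Set.finite_singleton x).subset fun y hy => by
    by_contra hne
    simp [Pi.single_eq_of_ne hne] at hy)

open Classical in
lemma delta_apply (x y : Γ) : delta x y = if y = x then 1 else 0 := by
  exact Pi.single_apply x 1 y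

lemma inner_delta_left (x : Γ) (f : EllTwo Γ) : inner ℂ (delta x) f = f x := by
  classical
  refine (hasSum_inner (delta x) f).unique ?_
  convert! hasSum_ite_eq x (f x) using 1
  funext y
  rw [delta_apply]
  split_ifs with hy
  · simp [hy]
  · simp

end EllTwo

open EllTwo

variable {Γ : Type*} [Group Γ]

lemma hasSum_norm_sq_mul_left (g : Γ) (f : EllTwo Γ) :
    HasSum (fun x => ‖f (g⁻¹ * x)‖ ^ 2) (‖f‖ ^ 2) :=
  (Equiv.mulLeft g⁻¹).hasSum_iff (f := fun x => ‖f x‖ ^ 2) |>.2 f.hasSum_norm_sq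

/-- Left translation on `ℓ²(Γ)`. -/
noncomputable def leftReg (g : Γ) : EllTwo Γ →ₗᵢ[ℂ] EllTwo Γ where
  toFun f := EllTwo.mk (fun x => f (g⁻¹ * x)) (hasSum_norm_sq_mul_left g f).summable
  map_add' _ _ := rfl
  map_smul' _ _ := rfl
  norm_map' f := by
    refine (pow_left_inj₀ (norm_nonneg _) (norm_nonneg _) two_ne_zero).1 ?_
    exact (EllTwo.hasSum_norm_sq (EllTwo.mk _ (hasSum_norm_sq_mul_left g f).summable)).unique
      (hasSum_norm_sq_mul_left g f)

lemma leftReg_apply (g : Γ) (f : EllTwo Γ) (x : Γ) : leftReg g f x = f (g⁻¹ * x) := rfl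

/-- The left regular representation as a homomorphism into the bounded operators. -/
noncomputable def leftRegHom : Γ →* (EllTwo Γ →L[ℂ] EllTwo Γ) where
  toFun g := (leftReg g).toContinuousLinearMap
  map_one' := by
    ext f x
    simp [leftReg_apply]
  map_mul' g k := by
    ext f x
    simp [leftReg_apply, mul_assoc]

/-- The left regular representation of the group ring. -/
noncomputable def regRep : MonoidAlgebra ℂ Γ →ₐ[ℂ] (EllTwo Γ →L[ℂ] EllTwo Γ) :=
  MonoidAlgebra.lift ℂ _ Γ leftRegHom

lemma regRep_single (g : Γ) (c : ℂ) (f : EllTwo Γ) :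
    regRep (MonoidAlgebra.single g c) f = c • leftReg g f := by
  simp [regRep, MonoidAlgebra.lift_single, leftRegHom]

lemma leftReg_mul (g k : Γ) (f : EllTwo Γ) : leftReg (g * k) f = leftReg g (leftReg k f) :=
  DFunLike.congr_fun (leftRegHom.map_mul g k) f

lemma leftReg_one (f : EllTwo Γ) : leftReg (1 : Γ) f = f :=
  DFunLike.congr_fun (leftRegHom.map_one (M := Γ)) f

lemma inner_leftReg_inv (g : Γ) (f k : EllTwo Γ) :
    inner ℂ (leftReg g⁻¹ f) k = inner ℂ f (leftReg g k) := by
  rw [← (leftReg g).inner_map_map, ← leftReg_mul, mul_inv_cancel, leftReg_one]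

lemma regRep_adjoint (a : MonoidAlgebra ℂ Γ) : regRep (adjoint a) = star (regRep a) := by
  induction a using MonoidAlgebra.induction_linear with
  | zero => simp [adjoint_zero]
  | add a b ha hb => rw [adjoint_add, map_add, ha, hb, map_add, star_add]
  | single g c =>
    rw [adjoint_single, ContinuousLinearMap.star_eq_adjoint,
      ContinuousLinearMap.eq_adjoint_iff]
    intro f k
    rw [regRep_single, regRep_single, inner_smul_left, inner_smul_right, inner_leftReg_inv]
    simp

/-- The positive operator `λ(h^* h)` on `ℓ²(Γ)`. -/
noncomputable def laplaceOp (Y : Finset Γ) : EllTwo Γ →L[ℂ] EllTwo Γ :=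
  regRep (adjoint (h Y) * h Y)

lemma laplaceOp_eq (Y : Finset Γ) : laplaceOp Y = star (regRep (h Y)) * regRep (h Y) := by
  rw [laplaceOp, map_mul, regRep_adjoint]

lemma laplaceOp_nonneg (Y : Finset Γ) : 0 ≤ laplaceOp Y := by
  rw [laplaceOp_eq]
  exact star_mul_self_nonneg _

lemma norm_laplaceOp (Y : Finset Γ) : ‖laplaceOp Y‖ = ‖regRep (h Y)‖ ^ 2 := by
  rw [laplaceOp_eq, CStarRing.norm_star_mul_self, sq]

lemma regRep_h_apply (Y : Finset Γ) (f : EllTwo Γ) : regRep (h Y) f = ∑ s ∈ Y, leftReg s f := by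
  simp [h, regRep_single, _root_.sum_apply]

lemma norm_regRep_h_le (Y : Finset Γ) : ‖regRep (h Y)‖ ≤ Y.card := by
  refine ContinuousLinearMap.opNorm_le_bound _ (by positivity) fun f => ?_
  rw [regRep_h_apply]
  refine (norm_sum_le _ _).trans ?_
  simp

lemma regRep_aeval (Y : Finset Γ) (p : Polynomial ℝ) :
    regRep (Polynomial.aeval (adjoint (h Y) * h Y) p) = Polynomial.aeval (laplaceOp Y) p :=
  (Polynomial.aeval_algHom_apply (regRep.restrictScalars ℝ) _ p).symm

lemma leftReg_delta (g x : Γ) : leftReg g (delta x) = delta (g * x) := by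
  classical
  ext y
  rw [leftReg_apply, delta_apply, delta_apply]
  simp only [inv_mul_eq_iff_eq_mul]

/-- Every point mass, not only the one at the identity, gives the trace. This freedom is what bounds
moments at general finitely supported vectors. -/
lemma inner_delta_regRep (a : MonoidAlgebra ℂ Γ) (x : Γ) :
    inner ℂ (delta x) (regRep a (delta x)) = trace a := by
  classical
  induction a using MonoidAlgebra.induction_linear with
  | zero => simp [trace]
  | add a b ha hb => simp [trace, ha, hb]
  | single g c =>
    rw [regRep_single, leftReg_delta, inner_smul_right, inner_delta_left, delta_apply, trace,
      MonoidAlgebra.coeff_single, Finsupp.single_apply]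
    simp

/-- Stands in for the spectral measure of A: polynomial inequalities on an interval become
inequalities between traces. -/
lemma reTrace_aeval_nonneg {Y : Finset Γ} {M : ℝ} (hM : ‖laplaceOp Y‖ ≤ M)
    {p : Polynomial ℝ} (hp : ∀ x, 0 ≤ x → x ≤ M → 0 ≤ p.eval x) :
    0 ≤ reTrace (Polynomial.aeval (adjoint (h Y) * h Y) p) := by
  rw [reTrace_apply, ← inner_delta_regRep _ 1, regRep_aeval]
  exact re_inner_nonneg (aeval_nonneg (laplaceOp_nonneg Y) hM hp) _

lemma moment_eq (Y : Finset Γ) (n : ℕ) :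
    moment Y n =
      reTrace (Polynomial.aeval (adjoint (h Y) * h Y) (Polynomial.X ^ n : Polynomial ℝ)) := by
  simp [moment, reTrace_apply]

lemma moment_nonneg (Y : Finset Γ) (n : ℕ) : 0 ≤ moment Y n := by
  rw [moment_eq]
  refine reTrace_aeval_nonneg le_rfl fun x hx _ => ?_
  simp only [Polynomial.eval_pow, Polynomial.eval_X]
  positivity

lemma moment_le {Y : Finset Γ} {M : ℝ} (hM : ‖laplaceOp Y‖ ≤ M) (n : ℕ) : moment Y n ≤ M ^ n := by
  have := reTrace_aeval_nonneg hM (p := Polynomial.C (M ^ n) - Polynomial.X ^ n) fun x hx hxM => by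
    simp only [Polynomial.eval_sub, Polynomial.eval_C, Polynomial.eval_pow, Polynomial.eval_X]
    have : x ^ n ≤ M ^ n := by gcongr
    linarith
  rw [map_sub, map_sub, ← moment_eq, Polynomial.aeval_C, Algebra.algebraMap_eq_smul_one, map_smul,
    reTrace_one, smul_eq_mul] at this
  linarith

end GroupCogrowth

namespace GroupCogrowth

open EllTwo

/-! ### From the norm of `λ(h)` to an invariant mean -/

section MulOp

variable {Γ : Type*}

lemma summable_norm_sq_mul (φ : lp (fun _ : Γ => ℝ) ∞) (f : EllTwo Γ) :
    (Summable fun x => ‖((φ x : ℝ) : ℂ) * f x‖ ^ 2) ∧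
      ∀ x, ‖((φ x : ℝ) : ℂ) * f x‖ ^ 2 ≤ ‖φ‖ ^ 2 * ‖f x‖ ^ 2 := by
  have hle : ∀ x, ‖((φ x : ℝ) : ℂ) * f x‖ ^ 2 ≤ ‖φ‖ ^ 2 * ‖f x‖ ^ 2 := by
    intro x
    rw [norm_mul, mul_pow, Complex.norm_real]
    have := lp.norm_apply_le_norm ENNReal.top_ne_zero φ x
    gcongr
  exact ⟨(f.hasSum_norm_sq.summable.mul_left _).of_nonneg_of_le (fun _ => by positivity) hle, hle⟩

/-- Multiplication by a bounded function on `ℓ²(Γ)`. -/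
noncomputable def mulOp (φ : lp (fun _ : Γ => ℝ) ∞) (f : EllTwo Γ) : EllTwo Γ :=
  EllTwo.mk (fun x => ((φ x : ℝ) : ℂ) * f x) (summable_norm_sq_mul φ f).1

lemma mulOp_apply (φ : lp (fun _ : Γ => ℝ) ∞) (f : EllTwo Γ) (x : Γ) :
    mulOp φ f x = ((φ x : ℝ) : ℂ) * f x := rfl

lemma norm_mulOp_le (φ : lp (fun _ : Γ => ℝ) ∞) (f : EllTwo Γ) : ‖mulOp φ f‖ ≤ ‖φ‖ * ‖f‖ := by
  refine le_of_sq_le_sq ?_ (by positivity)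
  rw [mul_pow]
  exact hasSum_le (summable_norm_sq_mul φ f).2 (mulOp φ f).hasSum_norm_sq
    (f.hasSum_norm_sq.mul_left _)

lemma mulOp_sub (φ : lp (fun _ : Γ => ℝ) ∞) (f g : EllTwo Γ) :
    mulOp φ (f - g) = mulOp φ f - mulOp φ g := by
  ext x
  simp [mulOp_apply, mul_sub]

/-- The average of a bounded function with respect to the density `|f|²`. -/
noncomputable def avg (f : EllTwo Γ) (φ : lp (fun _ : Γ => ℝ) ∞) : ℝ :=
  (inner ℂ f (mulOp φ f)).re

lemma avg_add (f : EllTwo Γ) (φ ψ : lp (fun _ : Γ => ℝ) ∞) :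
    avg f (φ + ψ) = avg f φ + avg f ψ := by
  have : mulOp (φ + ψ) f = mulOp φ f + mulOp ψ f := by
    ext x
    simp [mulOp_apply, add_mul]
  rw [avg, this, inner_add_right, Complex.add_re, avg, avg]

lemma avg_smul (f : EllTwo Γ) (c : ℝ) (φ : lp (fun _ : Γ => ℝ) ∞) :
    avg f (c • φ) = c * avg f φ := by
  have : mulOp (c • φ) f = (c : ℂ) • mulOp φ f := by
    ext x
    rw [EllTwo.smul_apply, mulOp_apply, mulOp_apply]
    simp [mul_assoc]
  rw [avg, this, inner_smul_right, Complex.re_ofReal_mul, avg]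

lemma avg_nonneg (f : EllTwo Γ) {φ : lp (fun _ : Γ => ℝ) ∞} (hφ : ∀ x, 0 ≤ φ x) :
    0 ≤ avg f φ := by
  have := Complex.hasSum_re (hasSum_inner f (mulOp φ f))
  refine this.nonneg fun x => ?_
  rw [mulOp_apply, mul_left_comm, ← Complex.normSq_eq_conj_mul_self, ← Complex.ofReal_mul,
    Complex.ofReal_re]
  exact mul_nonneg (hφ x) (Complex.normSq_nonneg _)

lemma avg_one (f : EllTwo Γ) : avg f 1 = ‖f‖ ^ 2 := by
  have : mulOp 1 f = f := by
    ext x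
    simp [mulOp_apply]
  rw [avg, this]
  exact (norm_sq_eq_re_inner (𝕜 := ℂ) f).symm

lemma abs_avg_le (f : EllTwo Γ) (φ : lp (fun _ : Γ => ℝ) ∞) : |avg f φ| ≤ ‖φ‖ * ‖f‖ ^ 2 := by
  refine (Complex.abs_re_le_norm _).trans ((norm_inner_le_norm _ _).trans ?_)
  nlinarith [norm_mulOp_le φ f, norm_nonneg f]

lemma abs_avg_sub_avg_le (f g : EllTwo Γ) (φ : lp (fun _ : Γ => ℝ) ∞) :
    |avg f φ - avg g φ| ≤ ‖φ‖ * (‖f‖ + ‖g‖) * ‖f - g‖ := by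
  have : avg f φ - avg g φ =
      (inner ℂ (f - g) (mulOp φ f)).re + (inner ℂ g (mulOp φ (f - g))).re := by
    rw [mulOp_sub, inner_sub_left, inner_sub_right, Complex.sub_re, Complex.sub_re, avg, avg]
    ring
  rw [this]
  have h1 : |(inner ℂ (f - g) (mulOp φ f)).re| ≤ ‖f - g‖ * (‖φ‖ * ‖f‖) :=
    (Complex.abs_re_le_norm _).trans ((norm_inner_le_norm _ _).trans
      (by gcongr; exact norm_mulOp_le φ f))
  have h2 : |(inner ℂ g (mulOp φ (f - g))).re| ≤ ‖g‖ * (‖φ‖ * ‖f - g‖) :=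
    (Complex.abs_re_le_norm _).trans ((norm_inner_le_norm _ _).trans
      (by gcongr; exact norm_mulOp_le φ _))
  refine (abs_add_le _ _).trans ((add_le_add h1 h2).trans (le_of_eq ?_))
  ring

end MulOp

variable {Γ : Type*} [Group Γ]

lemma avg_leftTranslate (g : Γ) (f : EllTwo Γ) (φ : lp (fun _ : Γ => ℝ) ∞) :
    avg f (leftTranslate g φ) = avg (leftReg g⁻¹ f) φ := by
  have : mulOp (leftTranslate g φ) f = leftReg g (mulOp φ (leftReg g⁻¹ f)) := by
    ext x
    simp [mulOp_apply, leftReg_apply, leftTranslate]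
  rw [avg, this, ← inner_leftReg_inv, avg]

lemma leftTranslate_mul (g k : Γ) (φ : lp (fun _ : Γ => ℝ) ∞) :
    leftTranslate (g * k) φ = leftTranslate g (leftTranslate k φ) := by
  ext x
  simp [leftTranslate, mul_assoc]

lemma leftTranslate_one (φ : lp (fun _ : Γ => ℝ) ∞) : leftTranslate (1 : Γ) φ = φ := by
  ext x
  simp [leftTranslate]

/-- Almost maximal vectors for `λ(h)` are almost invariant. -/
lemma norm_leftReg_sub_sq_le {Y : Finset Γ} {s t : Γ} (hs : s ∈ Y) (ht : t ∈ Y) {f : EllTwo Γ}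
    {ε : ℝ} (hε : ε ≤ 2) (hε0 : 0 ≤ ε) (hf : ‖f‖ ≤ 1) (hr : Y.card - ε ≤ ‖regRep (h Y) f‖) :
    ‖leftReg s f - leftReg t f‖ ^ 2 ≤ 4 * ε := by
  classical
  rcases eq_or_ne s t with rfl | hst
  · simpa using hε0
  have ht' : t ∈ Y.erase s := Finset.mem_erase.2 ⟨hst.symm, ht⟩
  rw [regRep_h_apply, ← Finset.add_sum_erase _ _ hs, ← Finset.add_sum_erase _ _ ht', ← add_assoc]
    at hr
  have hsum : ‖∑ x ∈ (Y.erase s).erase t, leftReg x f‖ ≤ Y.card - 2 := by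
    have h2 : 2 ≤ Y.card := Finset.one_lt_card.2 ⟨s, hs, t, ht, hst⟩
    have hc : ((Y.erase s).erase t).card = Y.card - 2 := by
      rw [Finset.card_erase_of_mem ht', Finset.card_erase_of_mem hs]; rfl
    refine (norm_sum_le _ _).trans ?_
    simp only [LinearIsometry.norm_map, Finset.sum_const, hc, nsmul_eq_mul]
    rw [Nat.cast_sub h2]
    have : (2 : ℝ) ≤ Y.card := by exact_mod_cast h2
    push_cast
    nlinarith
  have h1 := hr.trans (norm_add_le _ _)
  have h2 : 2 - ε ≤ ‖leftReg s f + leftReg t f‖ := by linarith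
  -- Gives ‖sf - tf‖² = 4‖f‖² - ‖sf + tf‖² ≤ 4 - (2 - ε)² ≤ 4ε; `hε` is needed to square 2 - ε.
  have h3 := parallelogram_law_with_norm ℂ (leftReg s f) (leftReg t f)
  simp only [LinearIsometry.norm_map] at h3
  nlinarith [norm_nonneg f]

/-- If `λ(h)` has the largest possible norm, then `Γ` is amenable. -/
lemma amenable_of_card_le_norm {Y : Finset Γ} (hne : Y.Nonempty)
    (hgen : Subgroup.closure ((Y : Set Γ)⁻¹ * (Y : Set Γ)) = ⊤)
    (hnorm : (Y.card : ℝ) ≤ ‖regRep (h Y)‖) : Amenable Γ := by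
  have hcard : (1 : ℝ) ≤ Y.card := by exact_mod_cast hne.card_pos
  have hex : ∀ k : ℕ, ∃ f : EllTwo Γ, ‖f‖ < 1 ∧ (Y.card : ℝ) - 1 / (k + 1) < ‖regRep (h Y) f‖ := by
    intro k
    have hk : (0 : ℝ) < 1 / (k + 1) := by positivity
    have hk1 : (1 : ℝ) / (k + 1) ≤ 1 := by
      rw [div_le_one (by positivity)]; linarith [(Nat.cast_nonneg k : (0 : ℝ) ≤ k)]
    exact (regRep (h Y)).exists_lt_apply_of_lt_opNorm (by linarith)
  choose f hf1 hf2 using hex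
  have hlim0 : Tendsto (fun k : ℕ => (1 : ℝ) / (k + 1)) atTop (𝓝 0) :=
    tendsto_one_div_add_atTop_nhds_zero_nat
  have hlim1 : Tendsto (fun k => ‖f k‖ ^ 2) atTop (𝓝 1) := by
    have hlow : ∀ k, 1 - (1 : ℝ) / (k + 1) ≤ ‖f k‖ := by
      intro k
      have h1 := (regRep (h Y)).le_of_opNorm_le (norm_regRep_h_le Y) (f k)
      have h2 := hf2 k
      have : (0 : ℝ) < 1 / (k + 1) := by positivity
      nlinarith [norm_nonneg (f k)]
    have : Tendsto (fun k => ‖f k‖) atTop (𝓝 1) := by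
      refine tendsto_of_tendsto_of_tendsto_of_le_of_le ?_ tendsto_const_nhds hlow
        fun k => (hf1 k).le
      simpa using hlim0.const_sub 1
    simpa using this.pow 2
  -- The mean is the limit along `U` of averages against |f_k|²; bounded sequences converge along an
  -- ultrafilter, so linearity and positivity pass to the limit.
  set U : Ultrafilter ℕ := hyperfilter ℕ with hU
  have hUle : (U : Filter ℕ) ≤ atTop := by
    rw [← Nat.cofinite_eq_atTop]; exact hyperfilter_le_cofinite
  have hm : ∀ φ : lp (fun _ : Γ => ℝ) ∞, ∃ c, Tendsto (fun k => avg (f k) φ) U (𝓝 c) := by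
    intro φ
    have hmem : ∀ k, avg (f k) φ ∈ Set.Icc (-‖φ‖) ‖φ‖ := by
      intro k
      rw [Set.mem_Icc, ← abs_le]
      refine (abs_avg_le _ _).trans (mul_le_of_le_one_right (norm_nonneg _) ?_)
      exact pow_le_one₀ (norm_nonneg _) (hf1 k).le
    obtain ⟨c, -, hc⟩ := (isCompact_Icc (a := -‖φ‖) (b := ‖φ‖)).ultrafilter_le_nhds
      (U.map fun k => avg (f k) φ) (by
        rw [le_principal_iff]; exact Filter.mem_map.2 (Filter.univ_mem' hmem))
    exact ⟨c, hc⟩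
  choose m hm using hm
  have hinv : ∀ s ∈ Y, ∀ t ∈ Y, ∀ φ, m (leftTranslate (s⁻¹ * t) φ) = m φ := by
    intro s hs t ht φ
    have hd : Tendsto (fun k => avg (f k) (leftTranslate (s⁻¹ * t) φ) - avg (f k) φ) atTop
        (𝓝 0) := by
      have hb : ∀ k : ℕ, ‖avg (f k) (leftTranslate (s⁻¹ * t) φ) - avg (f k) φ‖ ≤
          ‖φ‖ * 2 * √(4 * (1 / (k + 1))) := by
        intro k
        have hk1 : (1 : ℝ) / (k + 1) ≤ 2 := by
          rw [div_le_iff₀ (by positivity)]; linarith [(Nat.cast_nonneg k : (0 : ℝ) ≤ k)]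
        rw [avg_leftTranslate, Real.norm_eq_abs]
        refine (abs_avg_sub_avg_le _ _ φ).trans ?_
        have e : ‖leftReg (s⁻¹ * t)⁻¹ (f k) - f k‖ = ‖leftReg s (f k) - leftReg t (f k)‖ := by
          rw [← (leftReg t).norm_map, map_sub, ← leftReg_mul]
          simp
        rw [e, LinearIsometry.norm_map]
        have h1 : ‖leftReg s (f k) - leftReg t (f k)‖ ≤ √(4 * (1 / (k + 1))) :=
          Real.le_sqrt_of_sq_le (norm_leftReg_sub_sq_le hs ht hk1 (by positivity) (hf1 k).le
            (hf2 k).le)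
        have h2 : ‖f k‖ + ‖f k‖ ≤ 2 := by linarith [hf1 k]
        gcongr
      refine squeeze_zero_norm hb ?_
      have := ((hlim0.const_mul 4).sqrt).const_mul (‖φ‖ * 2)
      simpa using this
    have := tendsto_nhds_unique (hd.mono_left hUle) ((hm _).sub (hm φ))
    linarith
  refine ⟨⟨⟨m, fun φ ψ => ?_⟩, fun c φ => ?_⟩, fun φ hφ => ?_, ?_, ?_⟩
  · refine tendsto_nhds_unique (hm _) ?_
    simpa only [avg_add] using (hm φ).add (hm ψ)
  · refine tendsto_nhds_unique (hm _) ?_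
    simpa only [avg_smul, RingHom.id_apply, smul_eq_mul] using (hm φ).const_mul c
  · exact ge_of_tendsto' (hm φ) fun k => avg_nonneg (f k) hφ
  · refine tendsto_nhds_unique (hm 1) ?_
    simpa only [avg_one] using hlim1.mono_left hUle
  -- Almost maximality only controls the elements s⁻¹t. The elements fixing `m` form a subgroup, so
  -- generation gives full invariance.
  · let S : Subgroup Γ :=
      { carrier := {g | ∀ φ, m (leftTranslate g φ) = m φ}
        one_mem' := fun φ => by rw [leftTranslate_one]
        mul_mem' := fun {g k} hg hk φ => by rw [leftTranslate_mul, hg, hk]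
        inv_mem' := fun {g} hg φ => by
          rw [← hg, ← leftTranslate_mul, mul_inv_cancel, leftTranslate_one] }
    have hS : Subgroup.closure ((Y : Set Γ)⁻¹ * (Y : Set Γ)) ≤ S := by
      rw [Subgroup.closure_le]
      rintro _ ⟨a, ha, b, hb, rfl⟩ φ
      have := hinv a⁻¹ ha b hb φ
      rwa [inv_inv] at this
    intro g φ
    exact hS (hgen ▸ Subgroup.mem_top g) φ

end GroupCogrowth

namespace GroupCogrowth

open EllTwo

/-! ### From an invariant mean to lower bounds for the moments -/

section Reiter

variable {Γ : Type*} [Group Γ]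

open Classical in
/-- The boundary `∑_{g ∈ F} (δ_{(g, g x)} - δ_{(g, x)})` in `ℓ¹(Γ × Γ)` of a finitely supported
function. -/
noncomputable def boundary (F : Finset Γ) : (Γ →₀ ℝ) →ₗ[ℝ] lp (fun _ : Γ × Γ => ℝ) 1 :=
  Finsupp.linearCombination ℝ fun x =>
    ∑ g ∈ F, (lp.single 1 (g, g * x) (1 : ℝ) - lp.single 1 (g, x) (1 : ℝ))

lemma boundary_apply (F : Finset Γ) (p : Γ →₀ ℝ) {g : Γ} (hg : g ∈ F) (x : Γ) :
    boundary F p (g, x) = p (g⁻¹ * x) - p x := by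
  classical
  induction p using Finsupp.induction_linear with
  | zero => simp
  | add p₁ p₂ h₁ h₂ =>
    rw [map_add, lp.coeFn_add, Pi.add_apply, h₁, h₂, Finsupp.add_apply, Finsupp.add_apply]
    ring
  | single y c =>
    rw [boundary, Finsupp.linearCombination_single, lp.coeFn_smul, Pi.smul_apply, lp.coeFn_sum,
      Finset.sum_apply, Finset.sum_eq_single_of_mem g hg]
    · simp only [lp.coeFn_sub, Pi.sub_apply, lp.single_apply, Pi.single_apply, Prod.mk.injEq,
        true_and, Finsupp.single_apply, smul_eq_mul, mul_sub, mul_ite, mul_one, mul_zero,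
        eq_inv_mul_iff_mul_eq]
      simp only [eq_comm]
    · intro b _ hb
      simp [lp.single_apply, hb.symm]

/-- The finitely supported probability densities. -/
def probDensities (Γ : Type*) : Set (Γ →₀ ℝ) := {p | (∀ x, 0 ≤ p x) ∧ (p.sum fun _ c => c) = 1}

lemma convex_probDensities (Γ : Type*) : Convex ℝ (probDensities Γ) := by
  classical
  rintro p ⟨hp0, hp1⟩ r ⟨hr0, hr1⟩ a b ha hb hab
  refine ⟨fun x => ?_, ?_⟩
  · have := hp0 x
    have := hr0 x
    simp only [Finsupp.add_apply, Finsupp.smul_apply, smul_eq_mul]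
    positivity
  · rw [Finsupp.sum_add_index' (by simp) (by simp), Finsupp.sum_smul_index (by simp),
      Finsupp.sum_smul_index (by simp), ← Finsupp.mul_sum, ← Finsupp.mul_sum, hp1, hr1]
    simpa using hab

/-- In an amenable group there are finitely supported probability densities which are almost
invariant in the `ℓ¹`-norm. -/
lemma exists_norm_boundary_lt (hΓ : Amenable Γ) (F : Finset Γ) {ε : ℝ} (hε : 0 < ε) :
    ∃ p ∈ probDensities Γ, ‖boundary F p‖ < ε := by
  classical
  obtain ⟨m, hpos, hone, hinv⟩ := hΓ
  suffices h0 : (0 : lp (fun _ : Γ × Γ => ℝ) 1) ∈ closure (boundary F '' probDensities Γ) by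
    obtain ⟨_, ⟨p, hp, rfl⟩, hd⟩ := Metric.mem_closure_iff.1 h0 ε hε
    exact ⟨p, hp, by simpa using hd⟩
  by_contra h0
  -- Separation gives Φ ≥ u > 0 on all boundaries. Evaluated at point masses, Φ yields a bounded
  -- function ψ ≥ u that is a sum of differences φ_g(gx) - φ_g(x), so its mean is 0, a
  -- contradiction.
  obtain ⟨Φ, u, hu0, hu⟩ := geometric_hahn_banach_point_closed
    ((convex_probDensities Γ).linear_image (boundary F)).closure isClosed_closure h0
  rw [map_zero] at hu0
  have hbdd : ∀ g : Γ, Memℓp (fun x => Φ (lp.single 1 (g, x) (1 : ℝ))) ∞ := by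
    intro g
    refine memℓp_infty ⟨‖Φ‖, ?_⟩
    rintro _ ⟨x, rfl⟩
    refine (Φ.le_opNorm _).trans ?_
    rw [lp.norm_single (by norm_num)]
    simp
  let φ : Γ → lp (fun _ : Γ => ℝ) ∞ := fun g => ⟨fun x => Φ (lp.single 1 (g, x) (1 : ℝ)), hbdd g⟩
  let ψ : lp (fun _ : Γ => ℝ) ∞ := ∑ g ∈ F, (leftTranslate g⁻¹ (φ g) - φ g)
  have hψ : ∀ x, u ≤ ψ x := by
    intro x
    have hx := hu (boundary F (Finsupp.single x 1)) (subset_closure ⟨_, ⟨fun y => ?_, ?_⟩, rfl⟩)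
    · rw [boundary, Finsupp.linearCombination_single, one_smul, map_sum] at hx
      refine hx.le.trans (le_of_eq ?_)
      simp only [ψ, lp.coeFn_sum, Finset.sum_apply, map_sub]
      refine Finset.sum_congr rfl fun g _ => ?_
      simp only [leftTranslate, φ, inv_inv]
      rfl
    · rw [Finsupp.single_apply]; split_ifs <;> norm_num
    · simp
  have hm0 : m ψ = 0 := by
    simp only [ψ, map_sum, map_sub, hinv, sub_self, Finset.sum_const_zero]
  have h1 := hpos (ψ - u • 1) fun x => by
    change 0 ≤ ψ x - u * 1
    linarith [hψ x]
  rw [map_sub, map_smul, hm0, hone] at h1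
  simp only [smul_eq_mul, mul_one] at h1
  linarith

end Reiter

/-! ### From almost invariant ℓ¹ densities to almost invariant ℓ² unit vectors. -/

section SquareRoot

variable {Γ : Type*}

/-- The square root of a density as a vector in `ℓ²(Γ)`. -/
noncomputable def sqrtVec (p : Γ →₀ ℝ) : EllTwo Γ := ∑ x ∈ p.support, ((√(p x) : ℝ) : ℂ) • delta x

lemma sqrtVec_apply (p : Γ →₀ ℝ) (x : Γ) : sqrtVec p x = ((√(p x) : ℝ) : ℂ) := by
  classical
  have : sqrtVec p x = ∑ y ∈ p.support, ((√(p y) : ℝ) : ℂ) * delta y x := by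
    rw [← inner_delta_left, sqrtVec, inner_sum]
    simp only [inner_smul_right, inner_delta_left]
  rw [this]
  simp only [delta_apply, mul_ite, mul_one, mul_zero, Finset.sum_ite_eq, Finsupp.mem_support_iff]
  by_cases hx : p x = 0 <;> simp [hx]

lemma norm_sqrtVec {p : Γ →₀ ℝ} (hp : p ∈ probDensities Γ) : ‖sqrtVec p‖ = 1 := by
  have h1 := (sqrtVec p).hasSum_norm_sq
  have h2 : HasSum p 1 := by
    rw [← hp.2]
    exact hasSum_sum_of_ne_finset_zero fun x hx => by simpa using hx
  have h3 : (fun x => ‖sqrtVec p x‖ ^ 2) = p := by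
    funext x
    rw [sqrtVec_apply, Complex.norm_real, Real.norm_eq_abs, sq_abs, Real.sq_sqrt (hp.1 x)]
  rw [h3] at h1
  exact (pow_eq_one_iff_of_nonneg (norm_nonneg _) two_ne_zero).1 (h1.unique h2)

/-- Follows from |√a - √b| ≤ √a + √b; summed over Γ it bounds a squared ℓ² distance by an ℓ¹
distance. -/
lemma sqrt_sub_sqrt_sq_le {a b : ℝ} (ha : 0 ≤ a) (hb : 0 ≤ b) : (√a - √b) ^ 2 ≤ |a - b| := by
  have h1 : a - b = (√a - √b) * (√a + √b) := by
    nlinarith [Real.sq_sqrt ha, Real.sq_sqrt hb]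
  have h0 := Real.sqrt_nonneg a
  have h0' := Real.sqrt_nonneg b
  rw [h1, abs_mul, abs_of_nonneg (by positivity : 0 ≤ √a + √b), ← sq_abs, sq]
  refine mul_le_mul_of_nonneg_left ?_ (abs_nonneg _)
  rw [abs_le]
  constructor <;> linarith

lemma norm_leftReg_sqrtVec_sub_sq_le [Group Γ] {F : Finset Γ} {g : Γ} (hg : g ∈ F) {p : Γ →₀ ℝ}
    (hp : p ∈ probDensities Γ) : ‖leftReg g (sqrtVec p) - sqrtVec p‖ ^ 2 ≤ ‖boundary F p‖ := by
  classical
  refine hasSum_le_of_sum_le (leftReg g (sqrtVec p) - sqrtVec p).hasSum_norm_sq fun s => ?_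
  have h1 := lp.sum_rpow_le_norm_rpow (p := 1) (by norm_num) (boundary F p)
    (s.image fun x => (g, x))
  rw [Finset.sum_image (by simp)] at h1
  simp only [ENNReal.toReal_one, Real.rpow_one] at h1
  refine le_trans (Finset.sum_le_sum fun x _ => ?_) h1
  rw [boundary_apply F p hg, EllTwo.sub_apply, leftReg_apply, sqrtVec_apply, sqrtVec_apply,
    ← Complex.ofReal_sub, Complex.norm_real, Real.norm_eq_abs, sq_abs]
  exact sqrt_sub_sqrt_sq_le (hp.1 _) (hp.1 _)

end SquareRoot

/-! ### Lower bounds for the moments of an amenable group. -/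

variable {Γ : Type*} [Group Γ]

/-- In an amenable group, `λ(h)` almost attains its norm at square roots of densities. -/
lemma exists_lt_norm_regRep_sqrtVec (hΓ : Amenable Γ) {Y : Finset Γ} (hne : Y.Nonempty) {r : ℝ}
    (hr : r < Y.card) : ∃ p ∈ probDensities Γ, r < ‖regRep (h Y) (sqrtVec p)‖ := by
  classical
  obtain ⟨t, ht⟩ := hne
  have hN : (0 : ℝ) < Y.card := by exact_mod_cast Finset.card_pos.2 ⟨t, ht⟩
  -- Chosen so that |Y| errors of size below η add up to less than |Y| - r.
  set η := (Y.card - r) / Y.card with hη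
  have hη0 : 0 < η := div_pos (by linarith) hN
  obtain ⟨p, hp, hlt⟩ := exists_norm_boundary_lt hΓ (Y.image fun s => t⁻¹ * s)
    (show 0 < η ^ 2 by positivity)
  refine ⟨p, hp, ?_⟩
  have hs : ∀ s ∈ Y, ‖leftReg t (sqrtVec p) - leftReg s (sqrtVec p)‖ < η := by
    intro s hs
    have h1 := norm_leftReg_sqrtVec_sub_sq_le (Finset.mem_image_of_mem (fun s => t⁻¹ * s) hs) hp
    have h2 : ‖leftReg (t⁻¹ * s) (sqrtVec p) - sqrtVec p‖ < η :=
      lt_of_pow_lt_pow_left₀ 2 hη0.le (h1.trans_lt hlt)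
    rwa [← (leftReg t).norm_map, map_sub, ← leftReg_mul, mul_inv_cancel_left, norm_sub_rev] at h2
  have hsum : ∑ s ∈ Y, leftReg t (sqrtVec p) = regRep (h Y) (sqrtVec p) +
      ∑ s ∈ Y, (leftReg t (sqrtVec p) - leftReg s (sqrtVec p)) := by
    rw [regRep_h_apply, ← Finset.sum_add_distrib]
    simp
  have h1 : ‖∑ s ∈ Y, leftReg t (sqrtVec p)‖ = Y.card := by
    rw [Finset.sum_const, ← Nat.cast_smul_eq_nsmul ℝ, norm_smul, LinearIsometry.norm_map,
      norm_sqrtVec hp]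
    simp
  have h2 : ‖∑ s ∈ Y, (leftReg t (sqrtVec p) - leftReg s (sqrtVec p))‖ < Y.card - r := by
    refine (norm_sum_le _ _).trans_lt ((Finset.sum_lt_sum_of_nonempty ⟨t, ht⟩ hs).trans_eq ?_)
    rw [Finset.sum_const, nsmul_eq_mul, hη]
    field_simp
  have h3 := norm_add_le (regRep (h Y) (sqrtVec p))
    (∑ s ∈ Y, (leftReg t (sqrtVec p) - leftReg s (sqrtVec p)))
  rw [← hsum, h1] at h3
  linarith

/-- For a positive operator, the quadratic form at a nonnegative combination is controlled by its
values at the vectors that are combined. -/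
lemma re_inner_sum_le {H ι : Type*} [NormedAddCommGroup H] [InnerProductSpace ℂ H]
    [CompleteSpace H] {B : H →L[ℂ] H} (hB : 0 ≤ B) (s : Finset ι) (c : ι → ℝ) (v : ι → H) {M : ℝ}
    (hc : ∀ i, 0 ≤ c i) (hv : ∀ i, (inner ℂ (v i) (B (v i))).re ≤ M) :
    (inner ℂ (∑ i ∈ s, (c i : ℂ) • v i) (B (∑ i ∈ s, (c i : ℂ) • v i))).re ≤
      (∑ i ∈ s, c i) ^ 2 * M := by
  have hpos := (ContinuousLinearMap.nonneg_iff_isPositive B).1 hB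
  -- Positivity at v_i - v_j bounds twice the cross term by the two diagonal terms.
  have hij : ∀ i j, (inner ℂ (v i) (B (v j))).re ≤ M := by
    intro i j
    have h1 : 0 ≤ (inner ℂ (v i - v j) (B (v i - v j))).re := re_inner_nonneg hB _
    have h2 : (inner ℂ (v j) (B (v i))).re = (inner ℂ (v i) (B (v j))).re := by
      have h3 : inner ℂ (B (v j)) (v i) = inner ℂ (v j) (B (v i)) := hpos.isSymmetric (v j) (v i)
      rw [← h3]
      exact inner_re_symm (𝕜 := ℂ) _ _
    rw [map_sub, inner_sub_left, inner_sub_right, inner_sub_right] at h1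
    simp only [Complex.sub_re] at h1
    linarith [hv i, hv j]
  rw [map_sum, sum_inner, Complex.re_sum, sq, Finset.sum_mul, Finset.sum_mul]
  refine Finset.sum_le_sum fun i _ => ?_
  rw [inner_sum, Complex.re_sum, Finset.mul_sum, Finset.sum_mul]
  refine Finset.sum_le_sum fun j _ => ?_
  rw [map_smul, inner_smul_left, inner_smul_right, Complex.conj_ofReal, Complex.re_ofReal_mul,
    Complex.re_ofReal_mul, ← mul_assoc]
  exact mul_le_mul_of_nonneg_left (hij i j) (mul_nonneg (hc i) (hc j))

/-- Jensen's inequality for the moments of `λ(h^* h)`. -/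
lemma pow_le_re_inner_laplaceOp_pow (Y : Finset Γ) {f : EllTwo Γ} (hf : ‖f‖ = 1) {a : ℝ}
    (ha : 0 < a) (haf : a = ‖regRep (h Y) f‖ ^ 2) (n : ℕ) :
    a ^ n ≤ (inner ℂ f ((laplaceOp Y ^ n) f)).re := by
  have hff : (inner ℂ f f).re = 1 := by
    have := norm_sq_eq_re_inner (𝕜 := ℂ) f
    rw [hf] at this
    simpa using this.symm
  have hfT : (inner ℂ f (laplaceOp Y f)).re = a := by
    rw [haf, laplaceOp_eq, mul_apply_eq_comp, ContinuousLinearMap.star_eq_adjoint,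
      ContinuousLinearMap.adjoint_inner_right]
    exact (norm_sq_eq_re_inner (𝕜 := ℂ) _).symm
  -- The polynomial is xⁿ minus its tangent line at a, nonnegative by Bernoulli's inequality. At f
  -- the linear part vanishes because ⟨f, λ(A)f⟩ = a.
  have h1 := re_inner_nonneg (aeval_nonneg (laplaceOp_nonneg Y) le_rfl
    (p := Polynomial.X ^ n - Polynomial.C (a ^ n) -
      Polynomial.C (a ^ n * n / a) * (Polynomial.X - Polynomial.C a)) (fun x hx _ => by
    simp only [Polynomial.eval_sub, Polynomial.eval_pow, Polynomial.eval_X, Polynomial.eval_C,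
      Polynomial.eval_mul]
    have hb := one_add_mul_le_pow (a := x / a - 1) (by have := div_nonneg hx ha.le; linarith) n
    rw [add_sub_cancel, div_pow, le_div_iff₀ (by positivity)] at hb
    have : (1 + n * (x / a - 1)) * a ^ n = a ^ n + a ^ n * n / a * (x - a) := by
      field_simp
    linarith)) f
  simp only [map_sub, map_mul, map_pow, Polynomial.aeval_X, Polynomial.aeval_C,
    Algebra.algebraMap_eq_smul_one, smul_mul_assoc, one_mul,
    smul_pow, one_pow, _root_.sub_apply, _root_.smul_apply, one_apply_eq_self,
    inner_sub_right, inner_smul_right_eq_smul, Complex.sub_re, Complex.smul_re, hff, hfT,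
    smul_eq_mul] at h1
  linarith

/-- In an amenable group, the moments grow at least like `bⁿ` for every `b < |Y|²`. -/
lemma exists_mul_pow_le_moment (hΓ : Amenable Γ) {Y : Finset Γ} (hne : Y.Nonempty) {b : ℝ}
    (hb0 : 0 < b) (hb : b < (Y.card : ℝ) ^ 2) : ∃ c > 0, ∀ n, c * b ^ n ≤ moment Y n := by
  have hN : (0 : ℝ) < Y.card := by exact_mod_cast hne.card_pos
  obtain ⟨p, hp, hlt⟩ := exists_lt_norm_regRep_sqrtVec hΓ hne ((Real.sqrt_lt' hN).2 hb)
  set C := ∑ x ∈ p.support, √(p x) with hC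
  have hb' : b ≤ ‖regRep (h Y) (sqrtVec p)‖ ^ 2 := by
    rw [← Real.sq_sqrt hb0.le]; gcongr
  -- The vector is a finite nonnegative combination of point masses with total weight C, and each
  -- point mass has quadratic form m_n, so the loss C² does not depend on n.
  have key : ∀ n, b ^ n ≤ C ^ 2 * moment Y n := by
    intro n
    have hTn : 0 ≤ laplaceOp Y ^ n := by
      have := aeval_nonneg (laplaceOp_nonneg Y) le_rfl (p := Polynomial.X ^ n) fun x hx _ => by
        simpa using pow_nonneg hx n
      simpa using this
    refine (pow_le_pow_left₀ hb0.le hb' n).trans ?_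
    refine (pow_le_re_inner_laplaceOp_pow Y (norm_sqrtVec hp) (hb0.trans_le hb') rfl n).trans ?_
    refine re_inner_sum_le hTn p.support (fun x => √(p x)) delta
      (fun x => Real.sqrt_nonneg _) fun x => ?_
    rw [laplaceOp, ← map_pow, inner_delta_regRep, moment]
  have hCpos : 0 < C ^ 2 := by
    have := key 0
    have h1 : 0 ≤ C ^ 2 := sq_nonneg C
    rcases h1.eq_or_lt with h | h
    · rw [← h] at this; norm_num at this
    · exact h
  refine ⟨(C ^ 2)⁻¹, inv_pos.2 hCpos, fun n => ?_⟩
  rw [inv_mul_le_iff₀ hCpos]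
  exact key n

end GroupCogrowth

namespace GroupCogrowth

variable {Γ : Type*} [Group Γ]

/-! ### Growth rates in the amenable and the nonamenable case -/

lemma norm_laplaceOp_le {Y : Finset Γ} {q : ℕ} (hY : Y.card = q + 1) :
    ‖laplaceOp Y‖ ≤ ((q : ℝ) + 1) ^ 2 := by
  have h1 := norm_regRep_h_le Y
  rw [hY] at h1
  push_cast at h1
  rw [norm_laplaceOp]
  gcongr

lemma norm_laplaceOp_lt_of_not_amenable {Y : Finset Γ} {q : ℕ} (hY : Y.card = q + 1)
    (hgen : Subgroup.closure ((Y : Set Γ)⁻¹ * (Y : Set Γ)) = ⊤) (hΓ : ¬ Amenable Γ) :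
    ‖laplaceOp Y‖ < ((q : ℝ) + 1) ^ 2 := by
  have hne : Y.Nonempty := Finset.card_pos.1 (by omega)
  have h1 := not_le.1 fun h => hΓ (amenable_of_card_le_norm hne hgen h)
  rw [hY] at h1
  push_cast at h1
  rw [norm_laplaceOp]
  gcongr

/-- Lower bound for the number of closed cyclically reduced words in the amenable case. -/
lemma exists_mul_pow_le_zeta {Y : Finset Γ} {q : ℕ} (hq : 2 ≤ q) (hY : Y.card = q + 1)
    (hΓ : Amenable Γ) {b : ℝ} (hb : q < b) (hb2 : b < (q : ℝ) ^ 2) :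
    ∃ c > 0, ∀ᶠ n in atTop, c * b ^ n ≤ zeta Y n := by
  have hq0 : (2 : ℝ) ≤ q := by exact_mod_cast hq
  have hb0 : 0 < b := by linarith
  set N : ℝ := ((q : ℝ) + 1) ^ 2 with hN
  set x₀ : ℝ := b + q ^ 2 / b + 2 * q with hx₀
  have hx0 : 0 < x₀ := by positivity
  have hx0N : x₀ < N := by
    have := add_div_strictMono (q := q) (by linarith) hb.le hb2
    rw [div_self (by positivity)] at this
    rw [hN]; linarith
  obtain ⟨x₁, h01, h1N⟩ := exists_between hx0N
  obtain ⟨c, hc, hmom⟩ := exists_mul_pow_le_moment hΓ (Y := Y) (Finset.card_pos.1 (by omega))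
    (hx0.trans h01) (by rw [hY]; push_cast; exact h1N)
  -- Some moment exceeds x₀^k, which certifies spectral mass above x₀. This k stays fixed while n
  -- varies.
  obtain ⟨k, hk⟩ := (eventually_mul_pow_lt_mul_pow 1 hx0 h01 hc).exists
  set d := (moment Y k - x₀ ^ k) / N ^ k with hd
  have hN0 : 0 < N := by positivity
  have hd0 : 0 < d := div_pos (by linarith [hmom k]) (by positivity)
  have key : ∀ n, d * b ^ n ≤
      reTrace (Polynomial.aeval (adjoint (h Y) * h Y) (chebyPoly q n)) + 2 * q ^ n := by
    intro n
    -- Below x₀ the subtracted term is nonpositive and Q_n + 2qⁿ ≥ 0; above x₀ the subtracted term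
    -- is at most bⁿ ≤ Q_n.
    have h1 := reTrace_aeval_nonneg (norm_laplaceOp_le hY)
      (p := chebyPoly q n + Polynomial.C (2 * (q : ℝ) ^ n) -
        Polynomial.C (b ^ n / N ^ k) * (Polynomial.X ^ k - Polynomial.C (x₀ ^ k)))
      fun x hx hxN => by
        simp only [Polynomial.eval_sub, Polynomial.eval_add, Polynomial.eval_mul,
          Polynomial.eval_pow, Polynomial.eval_X, Polynomial.eval_C]
        rcases le_total x x₀ with hxx | hxx
        · have h1 := neg_le_chebyPoly_eval (q := q) (by omega) hx n
          have h2 : x ^ k - x₀ ^ k ≤ 0 := sub_nonpos.2 (by gcongr)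
          have h3 : b ^ n / N ^ k * (x ^ k - x₀ ^ k) ≤ 0 :=
            mul_nonpos_of_nonneg_of_nonpos (by positivity) h2
          linarith
        · have h1 := le_chebyPoly_eval (q := q) (by omega) hb hxx n
          have h2 : x ^ k - x₀ ^ k ≤ N ^ k := by
            have : x ^ k ≤ N ^ k := by gcongr
            have : 0 ≤ x₀ ^ k := by positivity
            linarith
          have h3 : b ^ n / N ^ k * (x ^ k - x₀ ^ k) ≤ b ^ n / N ^ k * N ^ k := by gcongr
          rw [div_mul_cancel₀ _ (by positivity)] at h3
          have : 0 ≤ 2 * (q : ℝ) ^ n := by positivity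
          linarith
    rw [← Polynomial.smul_eq_C_mul] at h1
    simp only [map_sub, map_add, map_smul] at h1
    rw [← moment_eq] at h1
    simp only [Polynomial.aeval_C, Algebra.algebraMap_eq_smul_one, map_smul, reTrace_one,
      smul_eq_mul, mul_one] at h1
    have : d * b ^ n = b ^ n / N ^ k * (moment Y k - x₀ ^ k) := by rw [hd]; ring
    linarith
  refine ⟨d / 2, by positivity, ?_⟩
  filter_upwards [eventually_mul_pow_lt_mul_pow 2 (by positivity) hb (half_pos hd0),
    eventually_ge_atTop 1] with n h1 h2
  obtain ⟨n, rfl⟩ := Nat.exists_eq_add_of_le' h2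
  rw [zeta_eq hY]
  linarith [key (n + 1)]

/-- Upper bound for the number of closed cyclically reduced words in the nonamenable case. -/
lemma exists_zeta_le_mul_pow {Y : Finset Γ} {q : ℕ} (hq : 2 ≤ q) (hY : Y.card = q + 1)
    (hgen : Subgroup.closure ((Y : Set Γ)⁻¹ * (Y : Set Γ)) = ⊤) (hΓ : ¬ Amenable Γ) :
    ∃ b : ℝ, q < b ∧ b < (q : ℝ) ^ 2 ∧ ∃ C, ∀ n, 1 ≤ n → zeta Y n ≤ C * b ^ n := by
  have hq0 : (2 : ℝ) ≤ q := by exact_mod_cast hq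
  have hlt := norm_laplaceOp_lt_of_not_amenable hY hgen hΓ
  -- At b = q² the right-hand side is (q+1)², so by continuity the strict norm bound survives for
  -- some smaller b.
  obtain ⟨b, hb1, hb2, hb3⟩ : ∃ b, (q : ℝ) < b ∧ b < (q : ℝ) ^ 2 ∧
      ‖laplaceOp Y‖ < b + q ^ 2 / b + 2 * q := by
    have hcont : ContinuousAt (fun b : ℝ => b + q ^ 2 / b + 2 * q) ((q : ℝ) ^ 2) := by
      have : (q : ℝ) ^ 2 ≠ 0 := by positivity
      fun_prop (disch := assumption)
    have hval : ‖laplaceOp Y‖ < (q : ℝ) ^ 2 + q ^ 2 / (q : ℝ) ^ 2 + 2 * q := by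
      rw [div_self (by positivity)]
      linarith
    have hev := (hcont.eventually_const_lt hval).filter_mono
      (nhdsWithin_le_nhds (s := Set.Iio ((q : ℝ) ^ 2)))
    have hqq : (q : ℝ) < (q : ℝ) ^ 2 := by nlinarith
    obtain ⟨b, h1, h2⟩ := (hev.and (Ioo_mem_nhdsLT hqq)).exists
    exact ⟨b, h2.1, h2.2, h1⟩
  refine ⟨b, hb1, hb2, 2 + (q - 1), fun n hn => ?_⟩
  obtain ⟨n, rfl⟩ := Nat.exists_eq_add_of_le' hn
  have h1 := reTrace_aeval_nonneg (Y := Y) hb3.le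
    (p := Polynomial.C (2 * b ^ (n + 1)) - chebyPoly q (n + 1)) fun x hx hxb => by
      simp only [Polynomial.eval_sub, Polynomial.eval_C]
      linarith [chebyPoly_eval_le (q := q) (by omega) hb1.le hx hxb (n + 1)]
  simp only [map_sub, Polynomial.aeval_C, Algebra.algebraMap_eq_smul_one, map_smul, reTrace_one,
    smul_eq_mul, mul_one] at h1
  rw [zeta_eq hY]
  have h2 : 1 ≤ b ^ (n + 1) := one_le_pow₀ (by linarith)
  nlinarith

lemma zeta_le_norm2_sq {Y : Finset Γ} {q : ℕ} (hq : 2 ≤ q) (hY : Y.card = q + 1) {n : ℕ}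
    (hn : 1 ≤ n) : 0 ≤ zeta Y n ∧ zeta Y n ≤ eta Y n ∧ eta Y n ≤ xi Y q n ∧
      xi Y q n ≤ norm2 (hSeq Y n) ^ 2 ∧
      norm2 (hSeq Y n) ^ 2 ≤ ((q : ℝ) + 1) ^ 2 * ((q : ℝ) ^ 2) ^ n := by
  obtain ⟨n, rfl⟩ := Nat.exists_eq_add_of_le' hn
  have hq0 : (1 : ℝ) ≤ (q : ℝ) ^ 2 := one_le_pow₀ (by exact_mod_cast (by omega : 1 ≤ q))
  refine ⟨zeta_nonneg Y _, zeta_le_eta Y _, eta_le_xi (by omega) hY n, ?_,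
    (norm2_hSeq_sq_le hY n).trans ?_⟩
  · rw [xi]
    have : 0 ≤ ((q : ℝ) + 1) * (q : ℝ) ^ (n + 1 - 1) := by positivity
    linarith
  · gcongr
    omega

/-- Brings condition (ii) into the form of the others. At n = 0 both exponents are 1/0 = 0. -/
lemma norm2_rpow_one_div (a : MonoidAlgebra ℂ Γ) (n : ℕ) :
    norm2 a ^ (1 / (n : ℝ)) = (norm2 a ^ 2) ^ (1 / (2 * (n : ℝ))) := by
  rw [← Real.rpow_natCast (norm2 a) 2, ← Real.rpow_mul (show 0 ≤ norm2 a from Real.sqrt_nonneg _)]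
  congr 1
  push_cast
  rcases eq_or_ne (n : ℝ) 0 with h0 | h0
  · simp [h0]
  · field_simp

end GroupCogrowth

theorem corollary7p9 {Γ : Type*} [Group Γ] (q : ℕ) (hq : 2 ≤ q) (Y : Finset Γ)
    (hY : Y.card = q + 1)
    (hgen : Subgroup.closure ((Y : Set Γ)⁻¹ * (Y : Set Γ)) = ⊤) :
    List.TFAE [
      GroupCogrowth.Amenable Γ,
      Tendsto (fun n : ℕ => GroupCogrowth.norm2 (GroupCogrowth.hSeq Y n) ^ (1 / (n : ℝ)))
        atTop (𝓝 (q : ℝ)),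
      Tendsto (fun n : ℕ => GroupCogrowth.xi Y q n ^ (1 / (2 * (n : ℝ)))) atTop (𝓝 (q : ℝ)),
      Tendsto (fun n : ℕ => GroupCogrowth.eta Y n ^ (1 / (2 * (n : ℝ)))) atTop (𝓝 (q : ℝ)),
      Tendsto (fun n : ℕ => GroupCogrowth.zeta Y n ^ (1 / (2 * (n : ℝ)))) atTop (𝓝 (q : ℝ))] ∧
    (GroupCogrowth.Amenable Γ ↔
      Tendsto (fun n : ℕ => GroupCogrowth.moment Y n ^ (1 / (2 * (n : ℝ)))) atTop
        (𝓝 ((q : ℝ) + 1))) := by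
  have hq0 : (2 : ℝ) ≤ q := by exact_mod_cast hq
  have hqpos : (0 : ℝ) < q := by linarith
  have hqq : (q : ℝ) < (q : ℝ) ^ 2 := by nlinarith
  have hchain := fun {n : ℕ} (hn : 1 ≤ n) => GroupCogrowth.zeta_le_norm2_sq hq hY hn
  -- In the amenable case every sequence between `ζ` and `‖h_n‖₂²` has growth rate `q`.
  have amen : ∀ x : ℕ → ℝ, (∀ n, 1 ≤ n → GroupCogrowth.zeta Y n ≤ x n ∧
      x n ≤ GroupCogrowth.norm2 (GroupCogrowth.hSeq Y n) ^ 2) → GroupCogrowth.Amenable Γ →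
      Tendsto (fun n : ℕ => x n ^ (1 / (2 * (n : ℝ)))) atTop (𝓝 (q : ℝ)) := by
    intro x hx hΓ
    -- The threshold `b₀` is q, since lower bounds for ζ_n are available only for b > q; q < q²
    -- because q ≥ 2.
    refine GroupCogrowth.tendsto_root hqpos hqq (C := ((q : ℝ) + 1) ^ 2) (fun b hb1 hb2 => ?_) ?_
    · obtain ⟨c, hc, hlow⟩ := GroupCogrowth.exists_mul_pow_le_zeta hq hY hΓ hb1 hb2
      refine ⟨c, hc, ?_⟩
      filter_upwards [hlow, eventually_ge_atTop 1] with n h1 h2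
      exact h1.trans (hx n h2).1
    · filter_upwards [eventually_ge_atTop 1] with n hn
      exact (hx n hn).2.trans (hchain hn).2.2.2.2
  -- In the nonamenable case no such sequence has growth rate `q`.
  have nonamen : ∀ x : ℕ → ℝ, (∀ n, 1 ≤ n → GroupCogrowth.zeta Y n ≤ x n ∧
      x n ≤ GroupCogrowth.norm2 (GroupCogrowth.hSeq Y n) ^ 2) →
      Tendsto (fun n : ℕ => x n ^ (1 / (2 * (n : ℝ)))) atTop (𝓝 (q : ℝ)) →
      GroupCogrowth.Amenable Γ := by
    intro x hx hlim
    by_contra hΓ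
    obtain ⟨b, hb1, hb2, C, hζ⟩ := GroupCogrowth.exists_zeta_le_mul_pow hq hY hgen hΓ
    have hb0 : 0 < b := hqpos.trans hb1
    obtain ⟨C₁, hη⟩ := GroupCogrowth.exists_le_mul_pow_of_rec (y := GroupCogrowth.eta Y)
      hqpos.le hb1 (fun n _ => GroupCogrowth.zeta_nonneg Y n) hζ (GroupCogrowth.eta_one Y)
      fun n hn => by
        obtain ⟨n, rfl⟩ := Nat.exists_eq_add_of_le' hn
        exact GroupCogrowth.eta_succ hY n
    obtain ⟨C₂, hξ⟩ := GroupCogrowth.exists_le_mul_pow_of_rec (y := GroupCogrowth.xi Y q)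
      hqpos.le hb1 (fun n hn => (hchain hn).1.trans (hchain hn).2.1) hη
      (GroupCogrowth.xi_one hY) fun n hn => by
        obtain ⟨n, rfl⟩ := Nat.exists_eq_add_of_le' hn
        exact GroupCogrowth.xi_succ hY n
    -- The extra q + 1 pays for the diagonal term (q+1)q^{n-1} ≤ (q+1)bⁿ separating ‖h_n‖₂² from
    -- ξ_n.
    refine GroupCogrowth.not_tendsto_root (C := C₂ + (q + 1)) hb0 hqpos hb2 ?_ ?_ hlim
    · filter_upwards [eventually_ge_atTop 1] with n hn
      exact (hchain hn).1.trans (hx n hn).1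
    · filter_upwards [eventually_ge_atTop 1] with n hn
      refine (hx n hn).2.trans ?_
      have h1 := hξ n hn
      have h2 : (q : ℝ) ^ (n - 1) ≤ b ^ n :=
        (pow_le_pow_right₀ (by linarith) (Nat.sub_le n 1)).trans (by gcongr)
      rw [GroupCogrowth.xi] at h1
      nlinarith
  simp only [GroupCogrowth.norm2_rpow_one_div]
  constructor
  · have equiv := fun (x : ℕ → ℝ) hx => Iff.intro (amen x hx) (nonamen x hx)
    tfae_have 1 ↔ 2 := equiv _ fun n hn =>
      ⟨(hchain hn).2.1.trans ((hchain hn).2.2.1.trans (hchain hn).2.2.2.1), le_rfl⟩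
    tfae_have 1 ↔ 3 := equiv _ fun n hn =>
      ⟨(hchain hn).2.1.trans (hchain hn).2.2.1, (hchain hn).2.2.2.1⟩
    tfae_have 1 ↔ 4 := equiv _ fun n hn =>
      ⟨(hchain hn).2.1, (hchain hn).2.2.1.trans (hchain hn).2.2.2.1⟩
    tfae_have 1 ↔ 5 := equiv _ fun n hn =>
      ⟨le_rfl, (hchain hn).2.1.trans ((hchain hn).2.2.1.trans (hchain hn).2.2.2.1)⟩
    tfae_finish
  · refine ⟨fun hΓ => ?_, fun hlim => ?_⟩
    · refine GroupCogrowth.tendsto_root (b₀ := 0) (C := 1) (by positivity) (by positivity)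
        (fun b hb1 hb2 => ?_) ?_
      · obtain ⟨c, hc, hlow⟩ := GroupCogrowth.exists_mul_pow_le_moment hΓ (Y := Y)
          (Finset.card_pos.1 (by omega)) hb1 (by rw [hY]; push_cast; exact hb2)
        exact ⟨c, hc, Eventually.of_forall hlow⟩
      · refine Eventually.of_forall fun n => ?_
        rw [one_mul]
        exact GroupCogrowth.moment_le (GroupCogrowth.norm_laplaceOp_le hY) n
    · by_contra hΓ
      have hlt := GroupCogrowth.norm_laplaceOp_lt_of_not_amenable hY hgen hΓ
      obtain ⟨b, hb1, hb2⟩ := exists_between hlt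
      refine GroupCogrowth.not_tendsto_root (C := 1) ((norm_nonneg _).trans_lt hb1)
        (by positivity) hb2 (Eventually.of_forall (GroupCogrowth.moment_nonneg Y)) ?_ hlim
      refine Eventually.of_forall fun n => ?_
      rw [one_mul]
      exact GroupCogrowth.moment_le hb1.le n
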